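/- Let $(X,d)$ be a nonempty compact metric space and let $T$ be a correspondence on $X$, i.e. an upper semicontinuous map from $X$ to the nonempty closed subsets of $X$ (for every $x$ and every open $U\supset T(x)$ there is a neighbourhood $V$ of $x$ with $T(y)\subset U$ for all $y\in V$); no expansiveness is assumed. For $n\ge 1$ put $\mathcal O_{n}(T)=\{(x_1,\dots,x_{n})\in X^{n}: x_{i+1}\in T(x_i),\ 1\le i<n\}$ with the maximum metric. For a continuous $\phi:\mathcal O_2(T)\to\mathbb R$ let $S_n\phi(x_1,\dots,x_{n+1})=\sum_{i=1}^n\phi(x_i,x_{i+1})$ and define the topological pressure $$P(T,\phi)=\lim_{\epsilon\to0^+}\limsup_{n\to\infty}\frac1n\log\sup_{E}\sum_{x\in E}e^{S_n\phi(x)}\in(-\infty,+\infty],$$ where $E$ ranges over the $\epsilon$-separated subsets of $\mathcal O_{n+1}(T)$ (distinct points are at distance $\ge\epsilon$). Let $h_{\mathrm{top}}(T)=P(T,0)$. A transition probability kernel $\mathcal Q$ on $X$ (with its Borel $\sigma$-algebra) is supported by $T$ if $\mathcal Q_x(T(x))=1$ for every $x\in X$; a Borel probability measure $\mu$ is $\mathcal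 Q$-invariant if $\mu\mathcal Q=\mu$, where $(\mu\mathcal Q)(A)=\int\mathcal Q_x(A)\,d\mu(x)$. Write $\iint\phi\,d\mathcal Q\,d\mu=\int_X\int_{T(x_1)}\phi(x_1,x_2)\,d\mathcal Q_{x_1}(x_2)\,d\mu(x_1)$. For $\mathcal Q$ supported by $T$ and a Borel probability measure $\mu$, the abstract measure-theoretic entropy is $$\mathfrak h_\mu(\mathcal Q)=\inf\Big\{\iint\phi\,d\mathcal Q\,d\mu:\ \phi\in C(\mathcal O_2(T)),\ P(T,-\phi)\le0\Big\}\in[-\infty,+\infty],\qquad \inf\emptyset=+\infty.$$ For a $\mathcal Q$-invariant $\mu$, the measure-theoretic entropy is $$h_\mu(\mathcal Q)=\sup_{\mathcal A}\lim_{n\to\infty}\frac1n H_{\mu\mathcal Q^{[n-1]}}(\mathcal A^n),$$ where $\mathcal A$ ranges over the finite measurable partitions of $X$, $\mathcal A^n$ is the product partition of $X^n$, $\mu\mathcal Q^{[n-1]}$ is the law of the first $n$ positions of the Markov chain with initial law $\mu$ and transition kernel $\mathcal Q$, and $H_\nu(\mathcal B)=-\sum_{B\in\mathcal B}\nu(B)\log\nu(B)$.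 Then the following hold. (i) For every continuous $\phi:\mathcal O_2(T)\to\mathbb R$, $$P(T,\phi)=\max_{\mathcal Q,\mu}\Big\{\mathfrak h_\mu(\mathcal Q)+\iint\phi\,d\mathcal Q\,d\mu\Big\},$$ where $\mathcal Q$ ranges over all transition probability kernels on $X$ supported by $T$ and $\mu$ ranges over all Borel probability measures on $X$; the same equality holds, with the maximum attained, when $\mu$ ranges only over the $\mathcal Q$-invariant Borel probability measures. (ii) If $h_{\mathrm{top}}(T)<+\infty$, then for every continuous $\phi:\mathcal O_2(T)\to\mathbb R$, every pair $(\mathcal Q,\mu)$ that attains the maximum in (i) satisfies $\mu\mathcal Q=\mu$. (iii) For every transition probability kernel $\mathcal Q$ on $X$ supported by $T$ and every Borel probability measure $\mu$ on $X$, $$\mathfrak h_\mu(\mathcal Q)=\inf_{\phi\in C(\mathcal O_2(T))}\Big\{P(T,\phi)-\iint\phi\,d\mathcal Q\,d\mu\Big\}.$$ (iv) For every transition probability kernel $\mathcal Q$ on $X$ supported by $T$ and every $\mathcal Q$-invariant Borel probability measure $\mu$ on $X$, $0\le h_\mu(\mathcal Q)\le\mathfrak h_\mu(\mathcal Q)$.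 -/

import Mathlib

open MeasureTheory ProbabilityTheory Filter Topology
open scoped ENNReal

/-- A correspondence on `X`: an upper semicontinuous map from `X` to the nonempty closed
subsets of `X`.  Upper semicontinuity at `x` says that every neighbourhood of the set `T x`
contains `T y` for all `y` close to `x`. -/
structure Correspondence (X : Type*) [TopologicalSpace X] where
  /-- The underlying set-valued map. -/
  toFun : X → Set X
  nonempty' : ∀ x, (toFun x).Nonempty
  isClosed' : ∀ x, IsClosed (toFun x)
  upperHemicontinuous' : UpperHemicontinuous toFun

namespace Correspondence

section Pressure

variable {X : Type*} [MetricSpace X]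

/-- The space `O₂(T)`, i.e. the graph of `T`. -/
def graph (T : Correspondence X) : Set (X × X) := {p | p.2 ∈ T.toFun p.1}

/-- The space `O_{n+1}(T)` of orbits `(x₀, …, xₙ)` of length `n + 1`.  As a subset of
`Fin (n + 1) → X` it carries the maximum metric. -/
def orbits (T : Correspondence X) (n : ℕ) : Set (Fin (n + 1) → X) :=
  {x | ∀ i : Fin n, x i.succ ∈ T.toFun (x i.castSucc)}

/-- The Birkhoff sum `Sₙφ(x₀, …, xₙ) = φ(x₀, x₁) + ⋯ + φ(xₙ₋₁, xₙ)`. -/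
noncomputable def birkhoff (T : Correspondence X) (φ : C(T.graph, ℝ)) (n : ℕ)
    (x : T.orbits n) : ℝ :=
  ∑ i : Fin n, φ ⟨(x.1 i.castSucc, x.1 i.succ), x.2 i⟩

/-- `sₙ(T, φ, ε)`: the supremum of `∑_{x ∈ E} exp (Sₙφ x)` over the `ε`-separated subsets `E`
of `O_{n+1}(T)`.  (In a compact space all `ε`-separated sets are finite.) -/
noncomputable def separatedSum (T : Correspondence X) (φ : C(T.graph, ℝ)) (ε : ℝ) (n : ℕ) :
    ℝ≥0∞ :=
  ⨆ (E : Finset (T.orbits n)) (_ : (E : Set (T.orbits n)).Pairwise fun x y => ε ≤ dist x y),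
    ∑ x ∈ E, ENNReal.ofReal (Real.exp (T.birkhoff φ n x))

/-- The pressure at scale `ε`: `limsup_{n → ∞} (1/n) log sₙ(T, φ, ε)`. -/
noncomputable def pressureAt (T : Correspondence X) (φ : C(T.graph, ℝ)) (ε : ℝ) : EReal :=
  limsup (fun n : ℕ => ENNReal.log (T.separatedSum φ ε n) / (n : EReal)) atTop

/-- The topological pressure `P(T, φ)`, the limit as `ε → 0⁺` of the pressure at scale `ε`.
It is written as a supremum because the pressure at scale `ε` is monotone in `ε`;
see `tendsto_pressureAt`. -/
noncomputable def pressure (T : Correspondence X) (φ : C(T.graph, ℝ)) : EReal :=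
  ⨆ (ε : ℝ) (_ : 0 < ε), T.pressureAt φ ε

/-- The topological entropy of `T`. -/
noncomputable def topEntropy (T : Correspondence X) : EReal := T.pressure 0

theorem pressureAt_antitone (T : Correspondence X) (φ : C(T.graph, ℝ)) :
    Antitone (T.pressureAt φ) := by
  intro ε δ h
  refine limsup_le_limsup (Eventually.of_forall fun n => ?_)
  refine EReal.div_le_div_right_of_nonneg (by positivity) (ENNReal.log_monotone ?_)
  exact iSup_mono fun E => iSup_le fun hE =>
    le_iSup (fun _ : (E : Set (T.orbits n)).Pairwise fun x y => ε ≤ dist x y =>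
      ∑ x ∈ E, ENNReal.ofReal (Real.exp (T.birkhoff φ n x)))
      (fun x hx y hy hxy => h.trans (hE hx hy hxy))

/-- The pressure is the limit, as `ε → 0⁺`, of the pressure at scale `ε`. -/
theorem tendsto_pressureAt (T : Correspondence X) (φ : C(T.graph, ℝ)) :
    Tendsto (T.pressureAt φ) (𝓝[>] 0) (𝓝 (T.pressure φ)) := by
  refine tendsto_order.2 ⟨fun a ha => ?_, fun a ha => ?_⟩
  · obtain ⟨ε, hε⟩ := lt_iSup_iff.1 ha
    obtain ⟨h0, hε⟩ := lt_iSup_iff.1 hε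
    filter_upwards [Ioc_mem_nhdsGT h0] with δ hδ
    exact hε.trans_le (T.pressureAt_antitone φ hδ.2)
  · filter_upwards [self_mem_nhdsWithin] with δ hδ
    exact (le_iSup₂ (f := fun (ε : ℝ) (_ : 0 < ε) => T.pressureAt φ ε) δ hδ).trans_lt ha

end Pressure

section Entropy

variable {X : Type*} [MetricSpace X] [MeasurableSpace X]

/-- The kernel `Q` is supported by `T`: `Q_x(T(x)) = 1` for every `x`. -/
def Supports (T : Correspondence X) (Q : Kernel X X) : Prop :=
  ∀ x, Q x (T.toFun x) = 1

/-- The double integral `∫_X ∫_{T(x₁)} φ(x₁, x₂) dQ_{x₁}(x₂) dμ(x₁)`.  The function `φ`, which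
lives on the graph of `T`, is extended by zero to `X × X`; the inner integral only sees its
values on the graph. -/
noncomputable def doubleIntegral (T : Correspondence X) (Q : Kernel X X) (μ : Measure X)
    (φ : C(T.graph, ℝ)) : ℝ :=
  ∫ x, ∫ y in T.toFun x, Function.extend Subtype.val φ 0 (x, y) ∂(Q x) ∂μ

/-- The abstract measure-theoretic entropy `𝔥_μ(Q)`: the infimum in `[-∞, ∞]` of `∬ φ dQ dμ`
over the continuous `φ` on the graph of `T` with `P(T, -φ) ≤ 0`. -/
noncomputable def abstractEntropy (T : Correspondence X) (Q : Kernel X X) (μ : Measure X) :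
    EReal :=
  ⨅ (φ : C(T.graph, ℝ)) (_ : T.pressure (-φ) ≤ 0), (T.doubleIntegral Q μ φ : EReal)

end Entropy

end Correspondence

section KernelEntropy

variable {X : Type*} [MeasurableSpace X]

theorem measurable_finSnoc (n : ℕ) :
    Measurable fun p : (Fin (n + 1) → X) × X => (Fin.snoc p.1 p.2 : Fin (n + 2) → X) := by
  refine measurable_pi_lambda _ fun i => ?_
  refine Fin.lastCases ?_ (fun j => ?_) i
  · simpa using measurable_snd
  · simp only [Fin.snoc_castSucc]
    exact (measurable_pi_apply j).comp measurable_fst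

/-- The kernel `Q^[n]` from `X` to `X^{n+1}`: the law of the first `n + 1` positions
`(x₀, …, xₙ)` of the Markov chain with transition kernel `Q` started at `x₀ = x`. -/
noncomputable def pathKernel (Q : Kernel X X) : (n : ℕ) → Kernel X (Fin (n + 1) → X)
  | 0 => Kernel.deterministic (fun x _ => x) (by fun_prop)
  | n + 1 =>
    (pathKernel Q n ⊗ₖ
      Q.comap (fun p : X × (Fin (n + 1) → X) => p.2 (Fin.last n)) (by fun_prop)).map
        fun p => Fin.snoc p.1 p.2

instance pathKernel_isMarkov (Q : Kernel X X) [IsMarkovKernel Q] (n : ℕ) :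
    IsMarkovKernel (pathKernel Q n) := by
  induction n with
  | zero => unfold pathKernel; infer_instance
  | succ n ih => unfold pathKernel; exact Kernel.IsMarkovKernel.map _ (measurable_finSnoc n)

/-- The recursion that defines `Q^[n]`. -/
theorem pathKernel_succ_apply (Q : Kernel X X) [IsMarkovKernel Q] (n : ℕ) (x : X)
    {A : Set (Fin (n + 2) → X)} (hA : MeasurableSet A) :
    pathKernel Q (n + 1) x A =
      ∫⁻ z, Q (z (Fin.last n)) {y | (Fin.snoc z y : Fin (n + 2) → X) ∈ A}
        ∂(pathKernel Q n x) := by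
  rw [pathKernel, Kernel.map_apply' _ (measurable_finSnoc n) _ hA,
    Kernel.compProd_apply (measurable_finSnoc n hA)]
  rfl

/-- A finite measurable partition of `X`, as a family of sets indexed by `{0, …, card - 1}`. -/
structure FinMeasPartition (X : Type*) [MeasurableSpace X] where
  /-- The number of members. -/
  card : ℕ
  /-- The members of the partition. -/
  part : Fin card → Set X
  measurableSet_part : ∀ i, MeasurableSet (part i)
  disjoint_part : Pairwise fun i j => Disjoint (part i) (part j)
  iUnion_part : ⋃ i, part i = Set.univ

/-- The Shannon entropy `H_ν(𝒜ⁿ) = -∑ ν(B) log ν(B)`, where `B = A₁ × ⋯ × Aₙ` runs over the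
members of the product partition `𝒜ⁿ` of `Xⁿ` (with `0 log 0 = 0`). -/
noncomputable def productEntropy {n : ℕ} (ν : Measure (Fin n → X)) (A : FinMeasPartition X) :
    ℝ :=
  ∑ s : Fin n → Fin A.card, Real.negMulLog (ν.real (Set.univ.pi fun i => A.part (s i)))

/-- The entropy `h_μ(Q, 𝒜) = lim_{n → ∞} (1/n) H_{μQ^[n-1]}(𝒜ⁿ)`, with `n` shifted by one.
The limit exists (by subadditivity) when `μ` is a `Q`-invariant probability measure, the case
in which it is used, so that it equals the upper limit taken here. -/
noncomputable def kernelEntropyPartition (Q : Kernel X X) (μ : Measure X)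
    (A : FinMeasPartition X) : EReal :=
  limsup (fun n : ℕ =>
    ((productEntropy (μ.bind (pathKernel Q n)) A / ((n : ℝ) + 1) : ℝ) : EReal)) atTop

/-- The measure-theoretic entropy `h_μ(Q)` of the kernel `Q` for `μ`: the supremum of
`h_μ(Q, 𝒜)` over all finite measurable partitions `𝒜` of `X`. -/
noncomputable def kernelEntropy (Q : Kernel X X) (μ : Measure X) : EReal :=
  ⨆ A : FinMeasPartition X, kernelEntropyPartition Q μ A

end KernelEntropy

/-!
Adding a constant `c` to `φ` adds `c` to `P(T, φ)`, so the constraint `P(T, -φ) ≤ 0` in the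
definition of `𝔥` can be normalized away; this is the inverse variational principle (iii), and with
it `𝔥_μ(Q) + ∬ φ dQ dμ ≤ P(T, φ)`.

For equality in (i), suppose first that `h_top(T) < ∞`. The pressure is then a finite convex
`1`-Lipschitz function on `C(O₂(T))` and has a subgradient at `φ`. Monotonicity and the behaviour
under constants make the subgradient a probability measure on the graph. A coboundary
`(x, y) ↦ u y - u x` has bounded Birkhoff sums and does not change the pressure, so this measure has
equal marginals; disintegrating it gives `Q` and an invariant `μ`. The same invariance under
coboundaries gives (ii). If `h_top(T) = ∞`, then `P(T, ·)` and `𝔥` are constantly `∞`, and only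
some invariant pair has to be found: it comes from a limit of empirical measures along one orbit.

For (iv), guess the itinerary of an orbit of length `n + 1` by drawing a point of an `ε`-separated
`ε`-net of the orbit space with probability proportional to `exp (Sₙφ)`, and then, independently in
each coordinate, a member of the partition near the corresponding coordinate of that point. Gibbs'
inequality bounds `H(𝒜ⁿ⁺¹)` by the mean of `-log` of the probability of a correct guess, which is
at most `log sₙ(T, φ, ε) - n ∬ φ dQ dμ` up to an error that is small relative to `n`.
-/

section General

theorem le_sub_coe_of_forall_lt {x y : EReal} {r : ℝ}
    (h : ∀ a : ℝ, y < a → x ≤ ((a - r : ℝ) : EReal)) : x ≤ y - r := by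
  rw [EReal.le_sub_iff_add_le (by simp) (by simp)]
  refine EReal.le_of_forall_lt_iff_le.1 fun a ha => ?_
  rw [← EReal.le_sub_iff_add_le (by simp) (by simp), ← EReal.coe_sub]
  exact h a ha

theorem log_div_natCast_le_coe_iff {n : ℕ} (hn : 0 < n) {s : ℝ≥0∞} {a : ℝ} :
    ENNReal.log s / (n : EReal) ≤ (a : EReal) ↔ s ≤ ENNReal.ofReal (Real.exp (n * a)) := by
  rw [EReal.div_le_iff_le_mul (by exact_mod_cast hn) (EReal.natCast_ne_top n),
    ← ENNReal.log_le_log_iff (y := ENNReal.ofReal _), ENNReal.log_ofReal_of_pos (Real.exp_pos _),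
    Real.log_exp, EReal.coe_mul]
  rfl

/- After the normalization `∑ exp f = ∑ exp g = 1`, Hölder's inequality is the convexity of `exp`,
summed over `E`. -/
theorem sum_exp_convexCombination_le {α : Type*} {E : Finset α} {f g : α → ℝ} {a b s t : ℝ}
    (hs : 0 ≤ s) (ht : 0 ≤ t) (hst : s + t = 1) (hf : ∑ x ∈ E, Real.exp (f x) ≤ Real.exp a)
    (hg : ∑ x ∈ E, Real.exp (g x) ≤ Real.exp b) :
    ∑ x ∈ E, Real.exp (s * f x + t * g x) ≤ Real.exp (s * a + t * b) := by
  have normalized : ∀ {h : α → ℝ} {c : ℝ}, ∑ x ∈ E, Real.exp (h x) ≤ Real.exp c →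
      ∑ x ∈ E, Real.exp (h x - c) ≤ 1 := fun {h c} hle => by
    simpa only [Real.exp_sub, ← Finset.sum_div] using div_le_one_of_le₀ hle (Real.exp_pos c).le
  have convex : ∀ x, Real.exp (s * f x + t * g x) ≤
      Real.exp (s * a + t * b) * (s * Real.exp (f x - a) + t * Real.exp (g x - b)) := fun x => by
    rw [show s * f x + t * g x = (s * a + t * b) + (s * (f x - a) + t * (g x - b)) by ring,
      Real.exp_add]
    gcongr
    exact convexOn_exp.2 (Set.mem_univ (f x - a)) (Set.mem_univ (g x - b)) hs ht hst
  calc ∑ x ∈ E, Real.exp (s * f x + t * g x)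
      ≤ ∑ x ∈ E, Real.exp (s * a + t * b) * (s * Real.exp (f x - a) + t * Real.exp (g x - b)) :=
        Finset.sum_le_sum fun x _ => convex x
    _ = Real.exp (s * a + t * b) *
        (s * ∑ x ∈ E, Real.exp (f x - a) + t * ∑ x ∈ E, Real.exp (g x - b)) := by
        simp only [Finset.mul_sum, ← Finset.sum_add_distrib]
    _ ≤ Real.exp (s * a + t * b) * (s * 1 + t * 1) := by
        gcongr
        exacts [normalized hf, normalized hg]
    _ = Real.exp (s * a + t * b) := by rw [mul_one, mul_one, hst, mul_one]

theorem sum_indicator_const_le_of_pairwise_disjoint {α ι : Type*} [Fintype ι] {s : ι → Set α}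
    (hs : Pairwise fun i j => Disjoint (s i) (s j)) {c : ℝ} (hc : 0 ≤ c) (x : α) :
    ∑ i, (s i).indicator (fun _ => c) x ≤ c := by
  have sum_eq := congrFun (Finset.indicator_biUnion (f := fun _ : α => c) Finset.univ s
    fun i _ j _ hij => hs hij) x
  rw [← sum_eq]
  exact Set.indicator_le_self' (fun _ _ => hc) x

theorem sum_mixture_prod_le_one {α ι κ : Type*} [Fintype ι] [DecidableEq ι] [Fintype κ]
    {E : Finset α} {p : α → ℝ} {w : α → ι → κ → ℝ} (hp : ∀ a, 0 ≤ p a) (hp' : ∑ a ∈ E, p a ≤ 1)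
    (hw : ∀ a i j, 0 ≤ w a i j) (hw' : ∀ a i, ∑ j, w a i j ≤ 1) :
    ∑ s : ι → κ, ∑ a ∈ E, p a * ∏ i, w a i (s i) ≤ 1 := by
  calc ∑ s : ι → κ, ∑ a ∈ E, p a * ∏ i, w a i (s i)
      = ∑ a ∈ E, p a * ∏ i, ∑ j, w a i j := by
        simp only [Finset.sum_comm (t := E), ← Finset.mul_sum, Finset.prod_univ_sum,
          Fintype.piFinset_univ]
    _ ≤ ∑ a ∈ E, p a * 1 := by
        gcongr with a
        · exact hp a
        · exact Finset.prod_le_one (fun i _ => Finset.sum_nonneg fun j _ => hw a i j)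
            fun i _ => hw' a i
    _ ≤ 1 := by simpa only [mul_one] using hp'

theorem exists_finset_separated_net (Y : Type*) [PseudoMetricSpace Y] [CompactSpace Y] {ε : ℝ}
    (hε : 0 < ε) :
    ∃ E : Finset Y, (E : Set Y).Pairwise (fun x y => ε ≤ dist x y) ∧
      ∀ x, ∃ z ∈ E, dist x z ≤ ε := by
  obtain ⟨δ, hδ, rfl⟩ : ∃ δ : NNReal, δ ≠ 0 ∧ ((2 * δ : NNReal) : ℝ) = ε :=
    ⟨⟨ε / 2, (half_pos hε).le⟩, fun h => (half_pos hε).ne' (congrArg NNReal.toReal h),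
      mul_div_cancel₀ ε two_ne_zero⟩
  obtain ⟨C, -, hCfin, hC⟩ := Metric.exists_finite_isCover_of_isCompact hδ (isCompact_univ (X := Y))
  have hfin : Metric.packingNumber (2 * δ) (Set.univ : Set Y) ≠ ⊤ :=
    ((Metric.packingNumber_two_mul_le_externalCoveringNumber δ _).trans
      hC.externalCoveringNumber_le_encard).trans_lt hCfin.encard_lt_top |>.ne
  have hEfin : (Metric.maximalSeparatedSet (2 * δ) (Set.univ : Set Y)).Finite := by
    rwa [← Set.encard_ne_top_iff, Metric.encard_maximalSeparatedSet hfin]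
  refine ⟨hEfin.toFinset, ?_, fun x => ?_⟩
  · rw [hEfin.coe_toFinset]
    refine Metric.isSeparated_maximalSeparatedSet.mono' fun x y hxy => ?_
    rw [edist_nndist, ENNReal.coe_lt_coe, ← NNReal.coe_lt_coe] at hxy
    exact hxy.le
  · obtain ⟨z, hz, hxz⟩ := Metric.isCover_maximalSeparatedSet hfin (Set.mem_univ x)
    refine ⟨z, hEfin.mem_toFinset.2 hz, ?_⟩
    replace hxz : edist x z ≤ (2 * δ : NNReal) := hxz
    rwa [edist_nndist, ENNReal.coe_le_coe, ← NNReal.coe_le_coe] at hxz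

theorem lowerSemicontinuous_comp_of_forall_le {X K α : Type*} [TopologicalSpace X]
    [TopologicalSpace K] [CompactSpace K] [LinearOrder α] {R : Set (X × K)} (hR : IsClosed R)
    {u : K → α} (hu : LowerSemicontinuous u) {m : X → K} (hm : ∀ x, (x, m x) ∈ R)
    (hmin : ∀ x c, (x, c) ∈ R → u (m x) ≤ u c) : LowerSemicontinuous fun x => u (m x) := by
  rw [lowerSemicontinuous_iff_isClosed_preimage] at hu ⊢
  intro a
  have h : (fun x => u (m x)) ⁻¹' Set.Iic a = Prod.fst '' (R ∩ Prod.snd ⁻¹' (u ⁻¹' Set.Iic a)) := by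
    ext x
    constructor
    · exact fun hx => ⟨(x, m x), ⟨hm x, hx⟩, rfl⟩
    · rintro ⟨⟨x, c⟩, ⟨hc, hca⟩, rfl⟩
      exact (hmin x c hc).trans hca
  rw [h]
  exact isClosedMap_fst_of_compactSpace _ (hR.inter ((hu a).preimage continuous_snd))

/- Parametrize `Y` by the Cantor set and select the least parameter in each section of `R`. -/
theorem exists_measurable_selection_of_isClosed {X Y : Type*} [TopologicalSpace X]
    [MeasurableSpace X] [OpensMeasurableSpace X] [MetricSpace Y] [CompactSpace Y]
    [MeasurableSpace Y] [BorelSpace Y] {R : Set (X × Y)} (hR : IsClosed R)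
    (hne : ∀ x, ∃ y, (x, y) ∈ R) : ∃ f : X → Y, Measurable f ∧ ∀ x, (x, f x) ∈ R := by
  rcases isEmpty_or_nonempty X with hX | ⟨⟨x₀⟩⟩
  · exact ⟨isEmptyElim, measurable_of_empty _, isEmptyElim⟩
  have : Nonempty Y := ⟨(hne x₀).choose⟩
  have : CompactSpace cantorSet := isCompact_iff_compactSpace.1 isCompact_cantorSet
  obtain ⟨g, hg, hsurj⟩ : ∃ g : cantorSet → Y, Continuous g ∧ Function.Surjective g := by
    obtain ⟨g, hg, hsurj⟩ := exists_nat_bool_continuous_surjective_of_compact Y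
    exact ⟨g ∘ cantorSetHomeomorphNatToBool, hg.comp cantorSetHomeomorphNatToBool.continuous,
      hsurj.comp cantorSetHomeomorphNatToBool.surjective⟩
  have hRg : IsClosed {p : X × cantorSet | (p.1, g p.2) ∈ R} := hR.preimage (by fun_prop)
  have exists_least : ∀ x, ∃ c : cantorSet, (x, g c) ∈ R ∧
      ∀ c' : cantorSet, (x, g c') ∈ R → (c : ℝ) ≤ c' := fun x => by
    obtain ⟨y, hy⟩ := hne x
    obtain ⟨c₀, rfl⟩ := hsurj y
    obtain ⟨c, hc, hmin⟩ := (hRg.preimage (by fun_prop : Continuous (Prod.mk x))).isCompact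
      |>.exists_isMinOn ⟨c₀, hy⟩ continuous_subtype_val.continuousOn
    exact ⟨c, hc, fun c' hc' => hmin hc'⟩
  choose m hm hmin using exists_least
  have hmeas : Measurable fun x => (m x : ℝ) :=
    (lowerSemicontinuous_comp_of_forall_le hRg continuous_subtype_val.lowerSemicontinuous hm
      hmin).measurable
  exact ⟨fun x => g (m x), hg.measurable.comp hmeas.subtype_mk, hm⟩

theorem exists_continuousLinearMap_le_sub_of_convexOn {E : Type*} [AddCommGroup E] [Module ℝ E]
    [TopologicalSpace E] [IsTopologicalAddGroup E] [ContinuousSMul ℝ E] {F : E → ℝ}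
    (hconv : ConvexOn ℝ Set.univ F) (hcont : Continuous F) (x : E) :
    ∃ g : E →L[ℝ] ℝ, ∀ y, g y ≤ F (x + y) - F x := by
  have hopen : IsOpen {p : E × ℝ | p.1 ∈ Set.univ ∧ F p.1 < p.2} := by
    simp only [Set.mem_univ, true_and]
    exact isOpen_lt (hcont.comp continuous_fst) continuous_snd
  obtain ⟨ℓ, hℓ⟩ := geometric_hahn_banach_point_open hconv.convex_strict_epigraph hopen
    (x := (x, F x)) (by simp)
  have above : ∀ y t, F (x + y) < t → 0 < ℓ (y, 0) + (t - F x) * ℓ (0, 1) := fun y t ht => by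
    have hsplit : ((x + y, t) : E × ℝ) = (x, F x) + ((y, 0) + (t - F x) • (0, 1)) := by
      ext <;> simp
    have h := hℓ (x + y, t) ⟨Set.mem_univ _, ht⟩
    rw [hsplit, map_add, map_add, map_smul, smul_eq_mul] at h
    linarith
  have hpos : 0 < ℓ (0, 1) := by
    simpa [← Prod.zero_eq_mk] using above 0 (F x + 1) (by simp)
  refine ⟨-(ℓ (0, 1))⁻¹ • ℓ.comp (.inl ℝ E ℝ), fun y => ?_⟩
  refine le_sub_iff_add_le.2 (le_of_forall_gt_imp_ge_of_dense fun t ht => ?_)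
  have h := mul_pos (inv_pos.2 hpos) (above y t ht)
  rw [mul_add, mul_left_comm, inv_mul_cancel₀ hpos.ne', mul_one] at h
  simp only [_root_.smul_apply, ContinuousLinearMap.comp_apply,
    ContinuousLinearMap.inl_apply, smul_eq_mul]
  linarith

section CompactHausdorff

variable {K : Type*} [TopologicalSpace K] [T2Space K] [CompactSpace K] [MeasurableSpace K]
  [BorelSpace K]

theorem exists_isProbabilityMeasure_integral_eq (g : C(K, ℝ) →ₗ[ℝ] ℝ)
    (hpos : ∀ f, (∀ p, 0 ≤ f p) → 0 ≤ g f) (hone : g 1 = 1) :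
    ∃ ν : Measure K, IsProbabilityMeasure ν ∧ ∀ f : C(K, ℝ), ∫ p, f p ∂ν = g f := by
  let Λ : CompactlySupportedContinuousMap K ℝ →ₚ[ℝ] ℝ := PositiveLinearMap.mk₀
    { toFun := fun f => g f.toContinuousMap
      map_add' := fun f f' => g.map_add f.toContinuousMap f'.toContinuousMap
      map_smul' := fun c f => g.map_smul c f.toContinuousMap } fun f hf => hpos _ fun p => hf p
  have hΛ : ∀ f : C(K, ℝ), ∫ p, f p ∂(RealRMK.rieszMeasure Λ) = g f := fun f =>
    RealRMK.integral_rieszMeasure Λ (CompactlySupportedContinuousMap.continuousMapEquiv f)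
  refine ⟨RealRMK.rieszMeasure Λ, ⟨?_⟩, hΛ⟩
  simpa [hone, Measure.real, ENNReal.toReal_eq_one_iff] using hΛ 1

theorem exists_isProbabilityMeasure_subgradient {F : C(K, ℝ) → ℝ}
    (hconv : ConvexOn ℝ Set.univ F)
    (hmono : ∀ (φ ψ : C(K, ℝ)) (c : ℝ), (∀ p, ψ p ≤ φ p + c) → F ψ ≤ F φ + c) (φ : C(K, ℝ)) :
    ∃ ν : Measure K, IsProbabilityMeasure ν ∧ ∀ ψ : C(K, ℝ), ∫ p, ψ p ∂ν ≤ F (φ + ψ) - F φ := by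
  have hlip : LipschitzWith 1 F := LipschitzWith.of_le_add fun ψ φ =>
    hmono φ ψ _ fun p => by
      have := (le_abs_self (ψ p - φ p)).trans (ContinuousMap.dist_apply_le_dist (f := ψ) (g := φ) p)
      linarith
  obtain ⟨g, hg⟩ := exists_continuousLinearMap_le_sub_of_convexOn hconv hlip.continuous φ
  have g_le : ∀ ψ c, (∀ p, ψ p ≤ c) → g ψ ≤ c := fun ψ c h => by
    have := hmono φ (φ + ψ) c fun p => by simpa using h p
    linarith [hg ψ]
  have g_nonneg : ∀ ψ, (∀ p, 0 ≤ ψ p) → 0 ≤ g ψ := fun ψ hψ => by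
    have := g_le (-ψ) 0 fun p => by simpa using hψ p
    rw [map_neg] at this
    linarith
  have g_one : g 1 = 1 := by
    have := g_le (-1) (-1) fun _ => by simp
    rw [map_neg] at this
    linarith [g_le 1 1 fun _ => by simp]
  obtain ⟨ν, hν, hνg⟩ := exists_isProbabilityMeasure_integral_eq g.toLinearMap g_nonneg g_one
  exact ⟨ν, hν, fun ψ => (hνg ψ).trans_le (hg ψ)⟩

theorem exists_isProbabilityMeasure_forall_tendsto_average (e : ℕ → K) :
    ∃ ν : Measure K, IsProbabilityMeasure ν ∧ ∀ (f : C(K, ℝ)) (c : ℝ),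
      Tendsto (fun n : ℕ => (∑ i ∈ Finset.range (n + 1), f (e i)) / (n + 1)) atTop (𝓝 c) →
        ∫ x, f x ∂ν = c := by
  let ν : ℕ → ProbabilityMeasure K := fun n =>
    ⟨(PMF.uniformOfFintype (Fin (n + 1))).toMeasure.map fun i : Fin (n + 1) => e i,
      Measure.isProbabilityMeasure_map (by fun_prop)⟩
  have hν : ∀ n (f : C(K, ℝ)), ∫ x, f x ∂(ν n : Measure K) =
      (∑ i ∈ Finset.range (n + 1), f (e i)) / (n + 1) := fun n f => by
    rw [ProbabilityMeasure.coe_mk, integral_map (by fun_prop) f.continuous.aestronglyMeasurable,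
      PMF.integral_eq_sum]
    simp only [PMF.uniformOfFintype_apply, Fintype.card_fin, ENNReal.toReal_inv,
      ENNReal.toReal_natCast, smul_eq_mul, ← Finset.mul_sum, Finset.sum_range, ← Nat.cast_add_one,
      div_eq_inv_mul]
  let U : Ultrafilter (ProbabilityMeasure K) := (hyperfilter ℕ).map ν
  refine ⟨U.lim, inferInstance, fun f c hc => tendsto_nhds_unique ?_
    (hc.mono_left Nat.hyperfilter_le_atTop)⟩
  have hlim : Tendsto ν (hyperfilter ℕ) (𝓝 U.lim) := U.le_nhds_lim
  exact (ProbabilityMeasure.tendsto_iff_forall_integral_tendsto.1 hlim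
    (BoundedContinuousFunction.mkOfCompact f)).congr fun n => hν n f

end CompactHausdorff

end General

namespace Correspondence

section Topology

variable {X : Type*} [MetricSpace X]

theorem isClosed_graph (T : Correspondence X) : IsClosed T.graph := by
  rw [← isOpen_compl_iff, isOpen_iff_mem_nhds]
  rintro ⟨x, y⟩ hxy
  obtain ⟨U, V, hU, hV, hyU, hTV, hUV⟩ :=
    normal_separation isClosed_singleton (T.isClosed' x) (Set.disjoint_singleton_left.2 hxy)
  have hnhds : ∀ᶠ x' in 𝓝 x, T.toFun x' ⊆ V :=
    upperHemicontinuous_iff_forall_isOpen.1 T.upperHemicontinuous' x V hV hTV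
  filter_upwards [prod_mem_nhds hnhds (hU.mem_nhds (hyU rfl))] with p hp hp'
  exact Set.disjoint_left.1 hUV hp.2 (hp.1 hp')

instance [CompactSpace X] (T : Correspondence X) : CompactSpace T.graph :=
  isCompact_iff_compactSpace.1 T.isClosed_graph.isCompact

theorem isClosed_orbits (T : Correspondence X) (n : ℕ) : IsClosed (T.orbits n) := by
  have : T.orbits n = ⋂ i : Fin n, (fun x : Fin (n + 1) → X => (x i.castSucc, x i.succ)) ⁻¹'
      T.graph := by
    ext x; simp [orbits, graph]
  rw [this]
  exact isClosed_iInter fun i => T.isClosed_graph.preimage (by fun_prop)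

instance [CompactSpace X] (T : Correspondence X) (n : ℕ) : CompactSpace (T.orbits n) :=
  isCompact_iff_compactSpace.1 (T.isClosed_orbits n).isCompact

theorem exists_orbit [Nonempty X] (T : Correspondence X) :
    ∃ x : ℕ → X, ∀ n, x (n + 1) ∈ T.toFun (x n) := by
  choose f hf using T.nonempty'
  refine ⟨fun n => f^[n] (Classical.arbitrary X), fun n => ?_⟩
  simp only [Function.iterate_succ_apply']
  exact hf _

instance [Nonempty X] (T : Correspondence X) (n : ℕ) : Nonempty (T.orbits n) := by
  obtain ⟨x, hx⟩ := T.exists_orbit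
  exact ⟨⟨fun i => x i, fun i => by simpa using hx i⟩⟩

end Topology

section Pressure

variable {X : Type*} [MetricSpace X] {T : Correspondence X} {φ ψ : C(T.graph, ℝ)} {ε a b : ℝ}
  {n : ℕ}

theorem separatedSum_le_ofReal_iff (ha : 0 ≤ a) :
    T.separatedSum φ ε n ≤ ENNReal.ofReal a ↔
      ∀ E : Finset (T.orbits n), (E : Set (T.orbits n)).Pairwise (fun x y => ε ≤ dist x y) →
        ∑ x ∈ E, Real.exp (T.birkhoff φ n x) ≤ a := by
  simp only [separatedSum, iSup_le_iff]
  refine forall₂_congr fun E _ => ?_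
  rw [← ENNReal.ofReal_sum_of_nonneg fun _ _ => (Real.exp_pos _).le,
    ENNReal.ofReal_le_ofReal_iff ha]

theorem pressureAt_le_coe (K : ℝ)
    (h : ∀ᶠ n : ℕ in atTop, T.separatedSum φ ε n ≤ ENNReal.ofReal (Real.exp (n * a + K))) :
    T.pressureAt φ ε ≤ a := by
  refine EReal.le_of_forall_lt_iff_le.1 fun b hab => ?_
  replace hab : a < b := by exact_mod_cast hab
  have hK : ∀ᶠ n : ℕ in atTop, K ≤ n * (b - a) :=
    (tendsto_natCast_atTop_atTop.atTop_mul_const (sub_pos.2 hab)).eventually_ge_atTop K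
  refine limsup_le_of_le (by isBoundedDefault) ?_
  filter_upwards [h, hK, eventually_gt_atTop 0] with n hn hKn hn0
  rw [log_div_natCast_le_coe_iff hn0]
  refine hn.trans (ENNReal.ofReal_le_ofReal (Real.exp_le_exp.2 ?_))
  linarith

theorem eventually_separatedSum_le (h : T.pressureAt φ ε < a) :
    ∀ᶠ n : ℕ in atTop, T.separatedSum φ ε n ≤ ENNReal.ofReal (Real.exp (n * a)) := by
  filter_upwards [eventually_lt_of_limsup_lt h, eventually_gt_atTop 0] with n hn hn0
  exact (log_div_natCast_le_coe_iff hn0).1 hn.le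

theorem pressureAt_le_pressure (hε : 0 < ε) : T.pressureAt φ ε ≤ T.pressure φ :=
  le_iSup₂ (f := fun (ε : ℝ) (_ : 0 < ε) => T.pressureAt φ ε) ε hε

theorem pressure_le_add_of_birkhoff_le (c K : ℝ)
    (h : ∀ n x, T.birkhoff ψ n x ≤ T.birkhoff φ n x + n * c + K) :
    T.pressure ψ ≤ T.pressure φ + c := by
  refine EReal.le_of_forall_lt_iff_le.1 fun b hb => iSup₂_le fun ε hε => pressureAt_le_coe K ?_
  have hlt : T.pressureAt φ ε < ((b - c : ℝ) : EReal) := by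
    refine (pressureAt_le_pressure hε).trans_lt ?_
    rw [EReal.coe_sub]
    exact (EReal.lt_sub_iff_add_lt (by simp) (by simp)).2 hb
  filter_upwards [eventually_separatedSum_le hlt] with n hn
  rw [separatedSum_le_ofReal_iff (Real.exp_pos _).le] at hn ⊢
  intro E hE
  calc ∑ x ∈ E, Real.exp (T.birkhoff ψ n x)
      ≤ ∑ x ∈ E, Real.exp (T.birkhoff φ n x) * Real.exp (n * c + K) :=
        Finset.sum_le_sum fun x _ => by
          rw [← Real.exp_add]; exact Real.exp_le_exp.2 (by linarith [h n x])
    _ ≤ Real.exp (n * (b - c)) * Real.exp (n * c + K) := by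
        rw [← Finset.sum_mul]; gcongr; exact hn E hE
    _ = Real.exp (n * b + K) := by rw [← Real.exp_add]; ring_nf

theorem pressure_le_add_of_le (c : ℝ) (h : ∀ p, ψ p ≤ φ p + c) :
    T.pressure ψ ≤ T.pressure φ + c := by
  refine pressure_le_add_of_birkhoff_le c 0 fun n x => ?_
  calc T.birkhoff ψ n x ≤ ∑ i : Fin n, (φ ⟨(x.1 i.castSucc, x.1 i.succ), x.2 i⟩ + c) :=
        Finset.sum_le_sum fun i _ => h _
    _ = T.birkhoff φ n x + n * c + 0 := by simp [Finset.sum_add_distrib, birkhoff]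

theorem pressure_add_const (φ : C(T.graph, ℝ)) (c : ℝ) :
    T.pressure (φ + ContinuousMap.const _ c) = T.pressure φ + c := by
  refine le_antisymm (pressure_le_add_of_le c fun p => by simp) ?_
  rw [← EReal.le_sub_iff_add_le (by simp) (by simp), sub_eq_add_neg, ← EReal.coe_neg]
  exact pressure_le_add_of_le (-c) fun p => by simp

theorem birkhoff_add (φ ψ : C(T.graph, ℝ)) (x : T.orbits n) :
    T.birkhoff (φ + ψ) n x = T.birkhoff φ n x + T.birkhoff ψ n x := by
  simp [birkhoff, Finset.sum_add_distrib]

theorem birkhoff_smul (c : ℝ) (φ : C(T.graph, ℝ)) (x : T.orbits n) :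
    T.birkhoff (c • φ) n x = c * T.birkhoff φ n x := by
  simp [birkhoff, Finset.mul_sum]

theorem pressure_smul_add_smul_le {s t : ℝ} (hs : 0 ≤ s) (ht : 0 ≤ t) (hst : s + t = 1)
    (hφ : T.pressure φ < a) (hψ : T.pressure ψ < b) :
    T.pressure (s • φ + t • ψ) ≤ ((s * a + t * b : ℝ) : EReal) := by
  refine iSup₂_le fun ε hε => pressureAt_le_coe 0 ?_
  filter_upwards [eventually_separatedSum_le ((pressureAt_le_pressure hε).trans_lt hφ),
    eventually_separatedSum_le ((pressureAt_le_pressure hε).trans_lt hψ)] with n hφn hψn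
  rw [separatedSum_le_ofReal_iff (Real.exp_pos _).le] at hφn hψn ⊢
  intro E hE
  have h := sum_exp_convexCombination_le hs ht hst (hφn E hE) (hψn E hE)
  simp only [birkhoff_add, birkhoff_smul]
  rwa [show n * (s * a + t * b) + 0 = s * (n * a) + t * (n * b) by ring]

/-- The coboundary `(x, y) ↦ u y - u x` of `u`, as a continuous function on the graph of `T`.
Its Birkhoff sums telescope, so adding it to a potential does not change the pressure. -/
def coboundary (T : Correspondence X) (u : C(X, ℝ)) : C(T.graph, ℝ) where
  toFun p := u p.1.2 - u p.1.1

theorem coboundary_neg (u : C(X, ℝ)) : T.coboundary (-u) = -T.coboundary u := by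
  ext p
  simp only [coboundary, ContinuousMap.coe_mk, ContinuousMap.neg_apply]
  ring

theorem birkhoff_coboundary (u : C(X, ℝ)) (x : T.orbits n) :
    T.birkhoff (T.coboundary u) n x = u (x.1 (Fin.last n)) - u (x.1 0) := by
  simp only [birkhoff, coboundary, ContinuousMap.coe_mk, Finset.sum_sub_distrib]
  have hsucc := Fin.sum_univ_succ fun i => u (x.1 i)
  have hcastSucc := Fin.sum_univ_castSucc fun i => u (x.1 i)
  linarith

variable [CompactSpace X]

theorem pressure_add_coboundary_le (φ : C(T.graph, ℝ)) (u : C(X, ℝ)) :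
    T.pressure (φ + T.coboundary u) ≤ T.pressure φ := by
  simpa using pressure_le_add_of_birkhoff_le (φ := φ) (ψ := φ + T.coboundary u) 0 (2 * ‖u‖)
    fun n x => by
      rw [birkhoff_add, birkhoff_coboundary]
      linarith [(abs_le.1 (u.norm_coe_le_norm (x.1 (Fin.last n)))).2,
        (abs_le.1 (u.norm_coe_le_norm (x.1 0))).1]

theorem pressure_add_coboundary (φ : C(T.graph, ℝ)) (u : C(X, ℝ)) :
    T.pressure (φ + T.coboundary u) = T.pressure φ := by
  refine le_antisymm (pressure_add_coboundary_le φ u) ?_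
  simpa [coboundary_neg] using pressure_add_coboundary_le (φ + T.coboundary u) (-u)

theorem tendsto_average_coboundary {x : ℕ → X} (hx : ∀ n, x (n + 1) ∈ T.toFun (x n))
    (u : C(X, ℝ)) :
    Tendsto (fun n : ℕ => (∑ i ∈ Finset.range (n + 1),
      T.coboundary u ⟨(x i, x (i + 1)), hx i⟩) / (n + 1)) atTop (𝓝 0) := by
  refine squeeze_zero_norm (a := fun n : ℕ => 2 * ‖u‖ * (1 / (n + 1))) (fun n => ?_)
    (by simpa using tendsto_one_div_add_atTop_nhds_zero_nat.const_mul (2 * ‖u‖))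
  have htelescope : ∑ i ∈ Finset.range (n + 1), T.coboundary u ⟨(x i, x (i + 1)), hx i⟩ =
      u (x (n + 1)) - u (x 0) := Finset.sum_range_sub (fun i => u (x i)) (n + 1)
  rw [htelescope, norm_div, ← Nat.cast_add_one, Real.norm_natCast, mul_one_div]
  gcongr
  linarith [norm_sub_le (u (x (n + 1))) (u (x 0)), u.norm_coe_le_norm (x (n + 1)),
    u.norm_coe_le_norm (x 0)]

theorem pressure_le_add_dist (φ ψ : C(T.graph, ℝ)) :
    T.pressure ψ ≤ T.pressure φ + (dist ψ φ : ℝ) :=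
  pressure_le_add_of_le _ fun p => by
    linarith [(le_abs_self _).trans (ContinuousMap.dist_apply_le_dist (f := ψ) (g := φ) p)]

theorem pressure_eq_top_iff_topEntropy (φ : C(T.graph, ℝ)) :
    T.pressure φ = ⊤ ↔ T.topEntropy = ⊤ := by
  have top_of_top : ∀ φ ψ : C(T.graph, ℝ), T.pressure ψ = ⊤ → T.pressure φ = ⊤ := fun φ ψ h => by
    have hle := pressure_le_add_dist φ ψ
    rw [h, top_le_iff] at hle
    by_contra hne
    exact (EReal.add_lt_top hne (EReal.coe_ne_top _)).ne hle
  exact ⟨top_of_top _ _, top_of_top _ _⟩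

theorem pressure_ne_bot [Nonempty X] (φ : C(T.graph, ℝ)) : T.pressure φ ≠ ⊥ := by
  have pressure_zero_nonneg : (0 : EReal) ≤ T.pressure 0 := by
    refine le_trans ?_ (pressureAt_le_pressure (φ := 0) one_pos)
    refine le_limsup_of_frequently_le (Frequently.of_forall fun n => ?_) (by isBoundedDefault)
    refine EReal.div_nonneg (ENNReal.zero_le_log_iff.2 ?_) (by positivity)
    refine le_iSup₂_of_le {Classical.arbitrary (T.orbits n)} (by simp) ?_
    simp [birkhoff]
  intro hbot
  have hle := pressure_zero_nonneg.trans (pressure_le_add_dist φ 0)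
  simp [hbot] at hle

theorem coe_toReal_pressure [Nonempty X] (h : T.topEntropy < ⊤) (φ : C(T.graph, ℝ)) :
    ((T.pressure φ).toReal : EReal) = T.pressure φ :=
  EReal.coe_toReal (fun htop => h.ne ((pressure_eq_top_iff_topEntropy φ).1 htop))
    (pressure_ne_bot φ)

theorem convexOn_toReal_pressure [Nonempty X] (h : T.topEntropy < ⊤) :
    ConvexOn ℝ Set.univ fun φ => (T.pressure φ).toReal := by
  refine ⟨convex_univ, fun φ _ ψ _ s t hs ht hst => le_of_forall_pos_le_add fun η hη => ?_⟩
  have hlt : ∀ φ : C(T.graph, ℝ), T.pressure φ < (((T.pressure φ).toReal + η : ℝ) : EReal) :=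
    fun φ => by
      conv_lhs => rw [← coe_toReal_pressure h φ]
      exact_mod_cast lt_add_of_pos_right _ hη
  have hle := pressure_smul_add_smul_le hs ht hst (hlt φ) (hlt ψ)
  rw [← coe_toReal_pressure h, EReal.coe_le_coe_iff] at hle
  refine hle.trans (le_of_eq ?_)
  simp only [smul_eq_mul]
  linear_combination η * hst

theorem toReal_pressure_le_add_of_le [Nonempty X] (h : T.topEntropy < ⊤) {c : ℝ}
    (hle : ∀ p, ψ p ≤ φ p + c) : (T.pressure ψ).toReal ≤ (T.pressure φ).toReal + c := by
  rw [← EReal.coe_le_coe_iff, EReal.coe_add, coe_toReal_pressure h, coe_toReal_pressure h]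
  exact pressure_le_add_of_le c hle

end Pressure

end Correspondence

namespace Correspondence

section DoubleIntegral

variable {X : Type*} [MetricSpace X] [MeasurableSpace X] [BorelSpace X] {T : Correspondence X}
  {Q : Kernel X X} {μ : Measure X}

theorem measurableSet_toFun (T : Correspondence X) (x : X) : MeasurableSet (T.toFun x) :=
  (T.isClosed' x).measurableSet

theorem Supports.ae_mem [IsMarkovKernel Q] (hQ : T.Supports Q) (x : X) :
    ∀ᵐ y ∂(Q x), y ∈ T.toFun x :=
  (prob_compl_eq_zero_iff (T.measurableSet_toFun x)).2 (hQ x)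

variable [CompactSpace X]

theorem measurableSet_graph (T : Correspondence X) : MeasurableSet T.graph :=
  T.isClosed_graph.measurableSet

/-- The joint law of two consecutive positions of the Markov chain with initial law `μ` and
transition kernel `Q`, as a measure on the graph of `T`. -/
noncomputable def graphMeasure (T : Correspondence X) (Q : Kernel X X) (μ : Measure X) :
    Measure T.graph :=
  (μ ⊗ₘ Q).comap Subtype.val

theorem measurable_extend (φ : C(T.graph, ℝ)) :
    Measurable (Function.extend Subtype.val φ (0 : X × X → ℝ)) :=
  (MeasurableEmbedding.subtype_coe T.measurableSet_graph).measurable_extend φ.measurable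
    measurable_zero

theorem integrable_extend (φ : C(T.graph, ℝ)) (ρ : Measure (X × X)) [IsFiniteMeasure ρ] :
    Integrable (Function.extend Subtype.val φ (0 : X × X → ℝ)) ρ := by
  refine .of_bound (measurable_extend φ).aestronglyMeasurable ‖φ‖ (.of_forall fun p => ?_)
  by_cases hp : ∃ q : T.graph, q.1 = p
  · obtain ⟨q, rfl⟩ := hp
    rw [Subtype.val_injective.extend_apply]
    exact φ.norm_coe_le_norm q
  · rw [Function.extend_apply' _ _ _ hp, Pi.zero_apply, norm_zero]
    exact norm_nonneg φ

variable [IsMarkovKernel Q]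

theorem Supports.ae_mem_graph (hQ : T.Supports Q) : ∀ᵐ p ∂(μ ⊗ₘ Q), p ∈ T.graph :=
  Measure.ae_compProd_of_ae_ae T.measurableSet_graph (.of_forall hQ.ae_mem)

theorem Supports.isProbabilityMeasure_graphMeasure [IsProbabilityMeasure μ] (hQ : T.Supports Q) :
    IsProbabilityMeasure (T.graphMeasure Q μ) := by
  constructor
  rw [graphMeasure, (MeasurableEmbedding.subtype_coe T.measurableSet_graph).comap_apply,
    Set.image_univ, Subtype.range_coe]
  exact (prob_compl_eq_zero_iff T.measurableSet_graph).1 hQ.ae_mem_graph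

theorem Supports.integral_graphMeasure (hQ : T.Supports Q) (f : X × X → ℝ) :
    ∫ p : T.graph, f p ∂(T.graphMeasure Q μ) = ∫ p, f p ∂(μ ⊗ₘ Q) := by
  rw [graphMeasure, integral_subtype_comap T.measurableSet_graph,
    Measure.restrict_eq_self_of_ae_mem hQ.ae_mem_graph]

variable [IsFiniteMeasure μ]

theorem Supports.doubleIntegral_eq_integral_extend (hQ : T.Supports Q) (φ : C(T.graph, ℝ)) :
    T.doubleIntegral Q μ φ = ∫ p, Function.extend Subtype.val φ 0 p ∂(μ ⊗ₘ Q) := by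
  rw [Measure.integral_compProd (integrable_extend φ _), doubleIntegral]
  simp only [Measure.restrict_eq_self_of_ae_mem (hQ.ae_mem _)]

theorem Supports.doubleIntegral_eq_integral_graphMeasure (hQ : T.Supports Q) (φ : C(T.graph, ℝ)) :
    T.doubleIntegral Q μ φ = ∫ p, φ p ∂(T.graphMeasure Q μ) := by
  rw [hQ.doubleIntegral_eq_integral_extend, ← hQ.integral_graphMeasure]
  simp only [Subtype.val_injective.extend_apply]

theorem Supports.doubleIntegral_add (hQ : T.Supports Q) (φ ψ : C(T.graph, ℝ)) :
    T.doubleIntegral Q μ (φ + ψ) = T.doubleIntegral Q μ φ + T.doubleIntegral Q μ ψ := by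
  have hint : ∀ φ : C(T.graph, ℝ), Integrable φ (T.graphMeasure Q μ) := fun φ =>
    have : IsFiniteMeasure (T.graphMeasure Q μ) := inferInstanceAs
      (IsFiniteMeasure ((μ ⊗ₘ Q).comap Subtype.val))
    φ.continuous.integrable_of_hasCompactSupport (.of_compactSpace _)
  simp only [hQ.doubleIntegral_eq_integral_graphMeasure]
  exact integral_add (hint φ) (hint ψ)

theorem Supports.doubleIntegral_neg (hQ : T.Supports Q) (φ : C(T.graph, ℝ)) :
    T.doubleIntegral Q μ (-φ) = -T.doubleIntegral Q μ φ := by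
  simp only [hQ.doubleIntegral_eq_integral_graphMeasure]
  exact integral_neg _

theorem Supports.doubleIntegral_const {μ : Measure X} [IsProbabilityMeasure μ]
    (hQ : T.Supports Q) (c : ℝ) : T.doubleIntegral Q μ (ContinuousMap.const _ c) = c := by
  have := hQ.isProbabilityMeasure_graphMeasure (μ := μ)
  simp [hQ.doubleIntegral_eq_integral_graphMeasure]

theorem Supports.doubleIntegral_coboundary (hQ : T.Supports Q) (u : C(X, ℝ)) :
    T.doubleIntegral Q μ (T.coboundary u) = ∫ x, u x ∂(μ.bind Q) - ∫ x, u x ∂μ := by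
  have integral_fst : ∫ p, u p.1 ∂(μ ⊗ₘ Q) = ∫ x, u x ∂μ := by
    conv_rhs => rw [← Measure.fst_compProd μ Q]
    exact (integral_map (by fun_prop) (by fun_prop)).symm
  have integral_snd : ∫ p, u p.2 ∂(μ ⊗ₘ Q) = ∫ x, u x ∂(μ.bind Q) := by
    rw [← Measure.snd_compProd μ Q]
    exact (integral_map (by fun_prop) (by fun_prop)).symm
  have integrable : ∀ f : C(X × X, ℝ), Integrable f (μ ⊗ₘ Q) := fun f =>
    f.continuous.integrable_of_hasCompactSupport (.of_compactSpace _)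
  calc T.doubleIntegral Q μ (T.coboundary u)
      = ∫ p : T.graph, (fun p : X × X => u p.2 - u p.1) p ∂(T.graphMeasure Q μ) :=
        hQ.doubleIntegral_eq_integral_graphMeasure _
    _ = ∫ p, u p.2 ∂(μ ⊗ₘ Q) - ∫ p, u p.1 ∂(μ ⊗ₘ Q) :=
        (hQ.integral_graphMeasure fun p => u p.2 - u p.1).trans
          (integral_sub (integrable (u.comp .snd)) (integrable (u.comp .fst)))
    _ = ∫ x, u x ∂(μ.bind Q) - ∫ x, u x ∂μ := by rw [integral_fst, integral_snd]

theorem Supports.invariant_of_doubleIntegral_coboundary (hQ : T.Supports Q)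
    (h : ∀ u : C(X, ℝ), T.doubleIntegral Q μ (T.coboundary u) = 0) : Q.Invariant μ :=
  ext_of_forall_integral_eq_of_IsFiniteMeasure fun u => by
    have hu := hQ.doubleIntegral_coboundary (μ := μ) u.toContinuousMap
    rw [h] at hu
    exact sub_eq_zero.1 hu.symm

end DoubleIntegral

section Disintegration

variable {X : Type*} [MetricSpace X] [CompactSpace X] [MeasurableSpace X] [BorelSpace X]
  [Nonempty X] {T : Correspondence X}

theorem exists_supports_compProd_eq (T : Correspondence X) {ρ : Measure (X × X)}
    [IsFiniteMeasure ρ] (hρ : ∀ᵐ p ∂ρ, p ∈ T.graph) :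
    ∃ Q : Kernel X X, IsMarkovKernel Q ∧ T.Supports Q ∧ ρ.fst ⊗ₘ Q = ρ := by
  have hdis : ρ.fst ⊗ₘ ρ.condKernel = ρ := ρ.disintegrate ρ.condKernel
  obtain ⟨f, hf, hfT⟩ := exists_measurable_selection_of_isClosed T.isClosed_graph T.nonempty'
  let G : Set X := {x | ρ.condKernel x (T.toFun x) = 1}
  have hG : MeasurableSet G :=
    Kernel.measurable_kernel_prodMk_left (κ := ρ.condKernel) T.measurableSet_graph
      (measurableSet_singleton 1)
  have ae_mem_G : ∀ᵐ x ∂ρ.fst, x ∈ G := by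
    rw [← hdis] at hρ
    filter_upwards [Measure.ae_ae_of_ae_compProd hρ] with x hx
    exact (prob_compl_eq_zero_iff (T.measurableSet_toFun x)).1 hx
  classical
  refine ⟨Kernel.piecewise hG ρ.condKernel (Kernel.deterministic f hf), inferInstance,
    fun x => ?_, ?_⟩
  · rw [Kernel.piecewise_apply']
    split_ifs with hx
    · exact hx
    · rw [Kernel.deterministic_apply' hf _ (T.measurableSet_toFun x),
        Set.indicator_of_mem (by exact hfT x)]
  · conv_rhs => rw [← hdis]
    refine Measure.compProd_congr ?_
    filter_upwards [ae_mem_G] with x hx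
    rw [Kernel.piecewise_apply, if_pos hx]

theorem exists_kernel_of_integral_coboundary_eq_zero {ν : Measure T.graph}
    [IsProbabilityMeasure ν] (hν : ∀ u : C(X, ℝ), ∫ p, T.coboundary u p ∂ν = 0) :
    ∃ (Q : Kernel X X) (μ : Measure X), IsMarkovKernel Q ∧ T.Supports Q ∧
      IsProbabilityMeasure μ ∧ Q.Invariant μ ∧ ∀ φ, T.doubleIntegral Q μ φ = ∫ p, φ p ∂ν := by
  have : IsProbabilityMeasure (ν.map Subtype.val) :=
    Measure.isProbabilityMeasure_map (by fun_prop)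
  obtain ⟨Q, hQm, hQ, hQν⟩ := T.exists_supports_compProd_eq (ρ := ν.map Subtype.val)
    ((ae_map_iff (by fun_prop) T.measurableSet_graph).2 (.of_forall fun p => p.2))
  have hint : ∀ φ, T.doubleIntegral Q (ν.map Subtype.val).fst φ = ∫ p, φ p ∂ν := fun φ => by
    rw [hQ.doubleIntegral_eq_integral_graphMeasure, graphMeasure, hQν,
      (MeasurableEmbedding.subtype_coe T.measurableSet_graph).comap_map]
  exact ⟨Q, _, hQm, hQ, inferInstance,
    hQ.invariant_of_doubleIntegral_coboundary fun u => (hint _).trans (hν u), hint⟩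

theorem exists_invariant (T : Correspondence X) :
    ∃ (Q : Kernel X X) (μ : Measure X), IsMarkovKernel Q ∧ T.Supports Q ∧
      IsProbabilityMeasure μ ∧ Q.Invariant μ := by
  obtain ⟨x, hx⟩ := T.exists_orbit
  obtain ⟨ν, _, hν⟩ := exists_isProbabilityMeasure_forall_tendsto_average
    fun n => (⟨(x n, x (n + 1)), hx n⟩ : T.graph)
  obtain ⟨Q, μ, hQm, hQ, hμ, hinv, -⟩ := exists_kernel_of_integral_coboundary_eq_zero (ν := ν)
    fun u => hν _ 0 (tendsto_average_coboundary hx u)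
  exact ⟨Q, μ, hQm, hQ, hμ, hinv⟩

theorem exists_kernel_subgradient {F : C(T.graph, ℝ) → ℝ} (hconv : ConvexOn ℝ Set.univ F)
    (hmono : ∀ (φ ψ : C(T.graph, ℝ)) (c : ℝ), (∀ p, ψ p ≤ φ p + c) → F ψ ≤ F φ + c)
    (hcob : ∀ φ u, F (φ + T.coboundary u) = F φ) (φ : C(T.graph, ℝ)) :
    ∃ (Q : Kernel X X) (μ : Measure X), IsMarkovKernel Q ∧ T.Supports Q ∧
      IsProbabilityMeasure μ ∧ Q.Invariant μ ∧
      ∀ ψ, F φ - T.doubleIntegral Q μ φ ≤ F ψ - T.doubleIntegral Q μ ψ := by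
  obtain ⟨ν, _, hν⟩ := exists_isProbabilityMeasure_subgradient hconv hmono φ
  have integral_coboundary_nonpos : ∀ u, ∫ p, T.coboundary u p ∂ν ≤ 0 := fun u => by
    simpa only [hcob, sub_self] using hν (T.coboundary u)
  have integral_coboundary : ∀ u, ∫ p, T.coboundary u p ∂ν = 0 := fun u => by
    refine le_antisymm (integral_coboundary_nonpos u) ?_
    simpa [coboundary_neg, integral_neg] using integral_coboundary_nonpos (-u)
  obtain ⟨Q, μ, hQm, hQ, hμ, hinv, hint⟩ :=
    exists_kernel_of_integral_coboundary_eq_zero integral_coboundary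
  refine ⟨Q, μ, hQm, hQ, hμ, hinv, fun ψ => ?_⟩
  have hsub := hν (ψ - φ)
  rw [add_sub_cancel, ← hint, sub_eq_add_neg, hQ.doubleIntegral_add, hQ.doubleIntegral_neg] at hsub
  linarith

end Disintegration

end Correspondence

section MeasurePreservingSum

variable {α β ι E : Type*} [MeasurableSpace α] [MeasurableSpace β] [Fintype ι]
  [NormedAddCommGroup E] {ν : Measure α} {μ : Measure β} {g : ι → α → β} {f : β → E}

theorem integrable_sum_comp_measurePreserving (hg : ∀ i, MeasurePreserving (g i) ν μ)
    (hf : Integrable f μ) : Integrable (fun x => ∑ i, f (g i x)) ν :=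
  integrable_finsetSum _ fun i _ => (hg i).integrable_comp_of_integrable hf

theorem integral_sum_comp_measurePreserving [NormedSpace ℝ E]
    (hg : ∀ i, MeasurePreserving (g i) ν μ) (hf : Integrable f μ) :
    ∫ x, ∑ i, f (g i x) ∂ν = Fintype.card ι • ∫ y, f y ∂μ := by
  have integral_comp : ∀ i, ∫ x, f (g i x) ∂ν = ∫ y, f y ∂μ := fun i => by
    rw [← (hg i).map_eq, integral_map (hg i).aemeasurable]
    rw [(hg i).map_eq]
    exact hf.aestronglyMeasurable
  calc ∫ x, ∑ i, f (g i x) ∂ν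
      = ∑ i, ∫ x, f (g i x) ∂ν :=
        integral_finsetSum _ fun i _ => (hg i).integrable_comp_of_integrable hf
    _ = Fintype.card ι • ∫ y, f y ∂μ := by
        simp only [integral_comp, Finset.sum_const, Finset.card_univ]

end MeasurePreservingSum

section MarkovChain

variable {X : Type*} [MeasurableSpace X] {Q : Kernel X X} {μ : Measure X}

theorem measurePreserving_prodMap_compProd_comap {α β : Type*} [MeasurableSpace α]
    [MeasurableSpace β] {κ : Kernel β X} [IsSFiniteKernel κ] {ν : Measure α} [SFinite ν]
    {ρ : Measure β} [SFinite ρ] {f : α → β} (hf : MeasurePreserving f ν ρ) :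
    MeasurePreserving (Prod.map f id) (ν ⊗ₘ κ.comap f hf.measurable) (ρ ⊗ₘ κ) := by
  have hfm : Measurable (Prod.map f (id : X → X)) := hf.measurable.prodMap measurable_id
  refine ⟨hfm, ?_⟩
  ext A hA
  rw [Measure.map_apply hfm hA, Measure.compProd_apply (hfm hA), Measure.compProd_apply hA,
    ← hf.lintegral_comp (Kernel.measurable_kernel_prodMk_left hA)]
  rfl

theorem bind_pathKernel_zero (Q : Kernel X X) (μ : Measure X) :
    μ.bind (pathKernel Q 0) = μ.map fun x _ => x := by
  rw [pathKernel, Measure.deterministic_comp_eq_map]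

variable [IsMarkovKernel Q] [SFinite μ]

theorem bind_pathKernel_succ (n : ℕ) :
    μ.bind (pathKernel Q (n + 1)) =
      (μ.bind (pathKernel Q n) ⊗ₘ Q.comap (fun z => z (Fin.last n)) (by fun_prop)).map
        fun p => Fin.snoc p.1 p.2 := by
  ext A hA
  rw [Measure.bind_apply hA (Kernel.aemeasurable _), Measure.map_apply (measurable_finSnoc n) hA,
    Measure.compProd_apply (measurable_finSnoc n hA), Measure.lintegral_bind (Kernel.aemeasurable _)
      (Kernel.measurable_kernel_prodMk_left (measurable_finSnoc n hA)).aemeasurable]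
  exact lintegral_congr fun x => pathKernel_succ_apply Q n x hA

theorem measurePreserving_init_last_pathKernel (n : ℕ) :
    MeasurePreserving (fun x : Fin (n + 2) → X => (Fin.init x, x (Fin.last (n + 1))))
      (μ.bind (pathKernel Q (n + 1)))
      (μ.bind (pathKernel Q n) ⊗ₘ Q.comap (fun z => z (Fin.last n)) (by fun_prop)) := by
  have hm : Measurable fun x : Fin (n + 2) → X => (Fin.init x, x (Fin.last (n + 1))) := by
    unfold Fin.init
    fun_prop
  refine ⟨hm, ?_⟩
  rw [bind_pathKernel_succ, Measure.map_map hm (measurable_finSnoc n)]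
  convert Measure.map_id
  ext p <;> simp

theorem measurePreserving_init_pathKernel (n : ℕ) :
    MeasurePreserving (Fin.init : (Fin (n + 2) → X) → Fin (n + 1) → X)
      (μ.bind (pathKernel Q (n + 1))) (μ.bind (pathKernel Q n)) :=
  MeasurePreserving.comp ⟨measurable_fst, Measure.fst_compProd _ _⟩
    (measurePreserving_init_last_pathKernel n)

theorem measurePreserving_last_pair_pathKernel {n : ℕ}
    (h : MeasurePreserving (fun x => x (Fin.last n)) (μ.bind (pathKernel Q n)) μ) :
    MeasurePreserving
      (fun x : Fin (n + 2) → X => (x (Fin.last n).castSucc, x (Fin.last (n + 1))))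
      (μ.bind (pathKernel Q (n + 1))) (μ ⊗ₘ Q) :=
  (measurePreserving_prodMap_compProd_comap h).comp (measurePreserving_init_last_pathKernel n)

theorem measurePreserving_eval_pathKernel (hμ : Q.Invariant μ) (n : ℕ) (i : Fin (n + 1)) :
    MeasurePreserving (fun x => x i) (μ.bind (pathKernel Q n)) μ := by
  induction n with
  | zero =>
    refine ⟨by fun_prop, ?_⟩
    rw [bind_pathKernel_zero, Measure.map_map (by fun_prop) (by fun_prop)]
    exact Measure.map_id
  | succ n ih =>
    refine Fin.lastCases ?_ (fun j => (ih j).comp (measurePreserving_init_pathKernel n)) i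
    have snd_compProd : (μ ⊗ₘ Q).map Prod.snd = μ :=
      (Measure.snd_compProd μ Q).trans hμ.def
    exact MeasurePreserving.comp ⟨measurable_snd, snd_compProd⟩
      (measurePreserving_last_pair_pathKernel (ih (Fin.last n)))

theorem measurePreserving_pair_pathKernel (hμ : Q.Invariant μ) (n : ℕ) (i : Fin n) :
    MeasurePreserving (fun x => (x i.castSucc, x i.succ)) (μ.bind (pathKernel Q n)) (μ ⊗ₘ Q) := by
  induction n with
  | zero => exact i.elim0
  | succ n ih =>
    exact Fin.lastCases
      (measurePreserving_last_pair_pathKernel (measurePreserving_eval_pathKernel hμ n _))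
      (fun j => (ih j).comp (measurePreserving_init_pathKernel n)) i

end MarkovChain

section Gibbs

variable {Ω : Type*} [MeasurableSpace Ω] {ν : Measure Ω} {G : Ω → ℝ}

theorem negMulLog_measureReal_add_setIntegral_le [IsFiniteMeasure ν] {s : Set Ω}
    (hs : MeasurableSet s) {q : ℝ} (hq : 0 ≤ q) (hG : IntegrableOn G s ν)
    (h : ∀ᵐ x ∂ν, x ∈ s → Real.exp (G x) ≤ q) :
    Real.negMulLog (ν.real s) + ∫ x in s, G x ∂ν ≤ q - ν.real s := by
  rcases eq_or_ne (ν s) 0 with h0 | h0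
  · simp [Measure.real, h0, Measure.restrict_eq_zero.2 h0, hq]
  have hp : 0 < ν.real s := ENNReal.toReal_pos h0 (measure_ne_top _ _)
  have exp_le : ∀ᵐ x ∂(ν.restrict s), Real.exp (G x) ≤ q := (ae_restrict_iff' hs).2 h
  have hqpos : 0 < q := by
    have : (ae (ν.restrict s)).NeBot := by rwa [ae_neBot, Ne, Measure.restrict_eq_zero]
    obtain ⟨x, hx⟩ := exp_le.exists
    exact (Real.exp_pos _).trans_le hx
  have setIntegral_le : ∫ x in s, G x ∂ν ≤ ν.real s * Real.log q := by
    calc ∫ x in s, G x ∂ν ≤ ∫ _ in s, Real.log q ∂ν :=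
          integral_mono_ae hG (integrable_const _) <| by
            filter_upwards [exp_le] with x hx using (Real.le_log_iff_exp_le hqpos).2 hx
      _ = ν.real s * Real.log q := by simp
  have log_le := mul_le_mul_of_nonneg_left (Real.log_le_sub_one_of_pos (div_pos hqpos hp)) hp.le
  rw [Real.log_div hqpos.ne' hp.ne', mul_sub, mul_sub, mul_div_cancel₀ _ hp.ne'] at log_le
  rw [Real.negMulLog]
  linarith

theorem sum_negMulLog_measureReal_le_neg_integral {ι : Type*} [Fintype ι] [IsProbabilityMeasure ν]
    {B : ι → Set Ω} (hB : ∀ i, MeasurableSet (B i))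
    (hdisj : Pairwise fun i j => Disjoint (B i) (B j)) (hcover : ⋃ i, B i = Set.univ)
    {q : ι → ℝ} (hq : ∀ i, 0 ≤ q i) (hq' : ∑ i, q i ≤ 1) (hG : Integrable G ν)
    (h : ∀ᵐ x ∂ν, ∀ i, x ∈ B i → Real.exp (G x) ≤ q i) :
    ∑ i, Real.negMulLog (ν.real (B i)) ≤ -∫ x, G x ∂ν := by
  have integral_eq : ∫ x, G x ∂ν = ∑ i, ∫ x in B i, G x ∂ν := by
    rw [← setIntegral_univ, ← hcover, integral_iUnion_fintype hB hdisj fun i => hG.integrableOn]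
  have sum_measureReal : ∑ i, ν.real (B i) = 1 := by
    rw [← measureReal_iUnion_fintype hdisj hB, hcover, probReal_univ]
  have cellwise := Finset.sum_le_sum fun i (_ : i ∈ Finset.univ) =>
    negMulLog_measureReal_add_setIntegral_le (hB i) (hq i) hG.integrableOn (h.mono fun x hx => hx i)
  rw [Finset.sum_add_distrib, Finset.sum_sub_distrib, ← integral_eq, sum_measureReal] at cellwise
  linarith

end Gibbs

section ProductEntropy

variable {X : Type*} [MeasurableSpace X] {n : ℕ} {ν : Measure (Fin n → X)}
  [IsProbabilityMeasure ν]

theorem productEntropy_nonneg (A : FinMeasPartition X) : 0 ≤ productEntropy ν A :=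
  Finset.sum_nonneg fun _ _ => Real.negMulLog_nonneg measureReal_nonneg measureReal_le_one

theorem productEntropy_le_neg_integral (A : FinMeasPartition X) {q : (Fin n → Fin A.card) → ℝ}
    (hq : ∀ s, 0 ≤ q s) (hq' : ∑ s, q s ≤ 1) {G : (Fin n → X) → ℝ} (hG : Integrable G ν)
    (h : ∀ᵐ x ∂ν, ∀ s, (∀ i, x i ∈ A.part (s i)) → Real.exp (G x) ≤ q s) :
    productEntropy ν A ≤ -∫ x, G x ∂ν := by
  refine sum_negMulLog_measureReal_le_neg_integral
    (fun s => .univ_pi fun i => A.measurableSet_part (s i)) (fun s t hst => ?_) ?_ hq hq' hG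
    (h.mono fun x hx s hs => hx s fun i => hs i trivial)
  · obtain ⟨i, hi⟩ := Function.ne_iff.1 hst
    exact Set.disjoint_univ_pi.2 ⟨i, A.disjoint_part hi⟩
  · rw [Set.iUnion_univ_pi fun _ : Fin n => A.part]
    simp only [A.iUnion_part, Set.pi_univ]

theorem kernelEntropy_nonneg (Q : Kernel X X) [IsMarkovKernel Q] (μ : Measure X)
    [IsProbabilityMeasure μ] : 0 ≤ kernelEntropy Q μ := by
  let trivialPartition : FinMeasPartition X :=
    { card := 1
      part := fun _ => Set.univ
      measurableSet_part := fun _ => .univ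
      disjoint_part := fun i j hij => absurd (Subsingleton.elim i j) hij
      iUnion_part := Set.iUnion_const _ }
  refine le_trans ?_ (le_iSup (kernelEntropyPartition Q μ) trivialPartition)
  refine le_limsup_of_frequently_le (.of_forall fun n => ?_) (by isBoundedDefault)
  exact EReal.coe_nonneg.2 (div_nonneg (productEntropy_nonneg _) (by positivity))

end ProductEntropy

namespace FinMeasPartition

variable {X : Type*} [MeasurableSpace X] [MetricSpace X] {A : FinMeasPartition X} {ε δ : ℝ}
  {B : Fin A.card → Set X}

/-- A guess of the member of a partition that contains an unknown point `x`, made from an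
`ε`-approximation `w` of `x`: the member `j` is guessed with probability at least `weight w j`, and
the member that contains `x` gets weight at least `exp (score x)` whatever `w` is. It bounds the
entropy of the partition through Gibbs' inequality. -/
structure IsCellPredictor (A : FinMeasPartition X) (ε : ℝ) (score : X → ℝ)
    (weight : X → Fin A.card → ℝ) : Prop where
  nonneg : ∀ w j, 0 ≤ weight w j
  sum_le_one : ∀ w, ∑ j, weight w j ≤ 1
  exp_score_le : ∀ {x w j}, x ∈ A.part j → dist x w ≤ ε → Real.exp (score x) ≤ weight w j

theorem IsCellPredictor.exp_sum_score_le {score : X → ℝ} {weight : X → Fin A.card → ℝ}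
    (hA : A.IsCellPredictor ε score weight) {n : ℕ} {x w : Fin n → X} {s : Fin n → Fin A.card}
    (hx : ∀ i, x i ∈ A.part (s i)) (hxw : ∀ i, dist (x i) (w i) ≤ ε) :
    Real.exp (∑ i, score (x i)) ≤ ∏ i, weight (w i) (s i) := by
  rw [Real.exp_sum]
  exact Finset.prod_le_prod (fun i _ => (Real.exp_pos _).le)
    fun i _ => hA.exp_score_le (hx i) (hxw i)

theorem isCellPredictor_cthickening (hBA : ∀ j, B j ⊆ A.part j)
    (hdisj : Pairwise fun i j =>
      Disjoint (Metric.cthickening ε (B i)) (Metric.cthickening ε (B j)))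
    (hδ : 0 < δ) (hcardδ : A.card * δ < 1) :
    A.IsCellPredictor ε
      (fun x => Real.log (1 - A.card * δ) + (⋃ j, B j)ᶜ.indicator (fun _ => Real.log δ) x)
      fun w j => (Metric.cthickening ε (B j)).indicator (fun _ => 1 - A.card * δ) w + δ where
  nonneg w j := add_nonneg (Set.indicator_nonneg (fun _ _ => (sub_pos.2 hcardδ).le) w) hδ.le
  sum_le_one w := by
    have := sum_indicator_const_le_of_pairwise_disjoint hdisj (sub_pos.2 hcardδ).le w
    rw [Finset.sum_add_distrib, Finset.sum_const, Finset.card_fin, nsmul_eq_mul]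
    linarith
  exp_score_le {x w j} hxj hxw := by
    have hc : 0 < 1 - A.card * δ := sub_pos.2 hcardδ
    rw [Real.exp_add, Real.exp_log hc]
    by_cases hx : x ∈ ⋃ j, B j
    · obtain ⟨i, hi⟩ := Set.mem_iUnion.1 hx
      obtain rfl : i = j := by
        by_contra hne
        exact Set.disjoint_left.1 (A.disjoint_part hne) (hBA i hi) hxj
      have hw : w ∈ Metric.cthickening ε (B i) :=
        Metric.mem_cthickening_of_dist_le w x ε _ hi (by rwa [dist_comm])
      rw [Set.indicator_of_notMem (Set.notMem_compl_iff.2 hx), Set.indicator_of_mem hw,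
        Real.exp_zero, mul_one]
      exact le_add_of_nonneg_right hδ.le
    · rw [Set.indicator_of_mem hx, Real.exp_log hδ]
      have hcle : 1 - A.card * δ ≤ 1 := sub_le_self _ (by positivity)
      exact (mul_le_of_le_one_left hδ.le hcle).trans
        (le_add_of_nonneg_left (Set.indicator_nonneg (fun _ _ => hc.le) w))

theorem eventually_pairwise_disjoint_cthickening (hBA : ∀ j, B j ⊆ A.part j)
    (hB : ∀ j, IsCompact (B j)) :
    ∀ᶠ ε in 𝓝[>] (0 : ℝ), Pairwise fun i j =>
      Disjoint (Metric.cthickening ε (B i)) (Metric.cthickening ε (B j)) := by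
  refine eventually_all.2 fun i => eventually_all.2 fun j => ?_
  by_cases hij : i = j
  · exact .of_forall fun _ h => absurd hij h
  obtain ⟨r, hr, hd⟩ := ((A.disjoint_part hij).mono (hBA i) (hBA j)).exists_cthickenings
    (hB i) (hB j).isClosed
  filter_upwards [Ioc_mem_nhdsGT hr] with ε hε _
  exact hd.mono (Metric.cthickening_mono hε.2 _) (Metric.cthickening_mono hε.2 _)

theorem exists_isCompact_subset_part [OpensMeasurableSpace X] (A : FinMeasPartition X)
    (μ : Measure X) [IsFiniteMeasure μ] [μ.InnerRegularCompactLTTop] {θ : ℝ} (hθ : 0 < θ) :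
    ∃ B : Fin A.card → Set X, (∀ j, IsCompact (B j)) ∧ (∀ j, B j ⊆ A.part j) ∧
      μ.real (⋃ j, B j)ᶜ ≤ θ := by
  choose B hBA hB hμB using fun j => (A.measurableSet_part j).exists_isCompact_sdiff_lt
    (measure_ne_top μ _) (ε := .ofReal (θ / (A.card + 1)))
    (by rw [Ne, ENNReal.ofReal_eq_zero, not_le]; positivity)
  refine ⟨B, hB, hBA, ?_⟩
  have compl_subset : (⋃ j, B j)ᶜ ⊆ ⋃ j, A.part j \ B j := fun x hx => by
    obtain ⟨j, hj⟩ := Set.mem_iUnion.1 (A.iUnion_part ▸ Set.mem_univ x)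
    exact Set.mem_iUnion.2 ⟨j, hj, fun hB => hx (Set.mem_iUnion.2 ⟨j, hB⟩)⟩
  calc μ.real (⋃ j, B j)ᶜ ≤ μ.real (⋃ j, A.part j \ B j) := measureReal_mono compl_subset
    _ ≤ ∑ j, μ.real (A.part j \ B j) := measureReal_iUnion_fintype_le _
    _ ≤ ∑ _ : Fin A.card, θ / (A.card + 1) := Finset.sum_le_sum fun j _ =>
        ENNReal.toReal_le_of_le_ofReal (by positivity) (hμB j).le
    _ ≤ θ := by
        rw [Finset.sum_const, Finset.card_fin, nsmul_eq_mul, mul_div_assoc',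
          div_le_iff₀ (by positivity)]
        nlinarith

theorem exists_isCellPredictor [OpensMeasurableSpace X] (A : FinMeasPartition X) (μ : Measure X)
    [IsProbabilityMeasure μ] [μ.InnerRegularCompactLTTop] {η : ℝ} (hη : 0 < η) :
    ∃ score : X → ℝ, Integrable score μ ∧ -η ≤ ∫ x, score x ∂μ ∧
      ∀ᶠ ε in 𝓝[>] 0, ∃ weight, A.IsCellPredictor ε score weight := by
  obtain ⟨δ, hδ, hδ1, hcardδ, hlog⟩ : ∃ δ : ℝ, 0 < δ ∧ δ ≤ 1 ∧ A.card * δ < 1 ∧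
      -(η / 2) ≤ Real.log (1 - A.card * δ) := by
    have card_mul : Tendsto (fun δ : ℝ => A.card * δ) (𝓝[>] 0) (𝓝 0) :=
      ((continuous_const_mul _).tendsto' _ _ (mul_zero _)).mono_left nhdsWithin_le_nhds
    have log_sub : Tendsto (fun δ : ℝ => Real.log (1 - A.card * δ)) (𝓝[>] 0) (𝓝 0) := by
      simpa using (card_mul.const_sub 1).log (by norm_num)
    obtain ⟨δ, hcardδ, hlog, hδ⟩ := ((card_mul.eventually_lt_const one_pos).and
      ((log_sub.eventually_const_le (by linarith : -(η / 2) < 0)).and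
        (Ioc_mem_nhdsGT one_pos))).exists
    exact ⟨δ, hδ.1, hδ.2, hcardδ, hlog⟩
  have neg_log_nonneg : 0 ≤ -Real.log δ := neg_nonneg.2 (Real.log_nonpos hδ.le hδ1)
  obtain ⟨B, hB, hBA, hμB⟩ := A.exists_isCompact_subset_part μ
    (θ := η / 2 / (-Real.log δ + 1)) (by positivity)
  have hN : MeasurableSet (⋃ j, B j)ᶜ := (MeasurableSet.iUnion fun j => (hB j).measurableSet).compl
  have integrable_indicator : Integrable ((⋃ j, B j)ᶜ.indicator fun _ => Real.log δ) μ :=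
    (integrable_const _).indicator hN
  refine ⟨fun x => Real.log (1 - A.card * δ) + (⋃ j, B j)ᶜ.indicator (fun _ => Real.log δ) x,
    (integrable_const _).add integrable_indicator, ?_, ?_⟩
  · have compl_mul_log : μ.real (⋃ j, B j)ᶜ * -Real.log δ ≤ η / 2 := by
      calc μ.real (⋃ j, B j)ᶜ * -Real.log δ
          ≤ η / 2 / (-Real.log δ + 1) * (-Real.log δ + 1) := by gcongr; linarith
        _ = η / 2 := div_mul_cancel₀ _ (by positivity)
    rw [integral_add (integrable_const _) integrable_indicator, integral_indicator_const _ hN,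
      integral_const, probReal_univ, one_smul, smul_eq_mul]
    linarith
  · filter_upwards [eventually_pairwise_disjoint_cthickening hBA hB] with ε hdisj
    exact ⟨_, isCellPredictor_cthickening hBA hdisj hδ hcardδ⟩

end FinMeasPartition

namespace Correspondence

section BirkhoffOscillation

variable {X : Type*} [MetricSpace X] {T : Correspondence X} {φ : C(T.graph, ℝ)} {n : ℕ}

theorem sum_extend_eq_birkhoff (x : T.orbits n) :
    ∑ i : Fin n, Function.extend Subtype.val φ 0 (x.1 i.castSucc, x.1 i.succ) =
      T.birkhoff φ n x :=
  Finset.sum_congr rfl fun i _ => Subtype.val_injective.extend_apply φ 0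
    (⟨(x.1 i.castSucc, x.1 i.succ), x.2 i⟩ : T.graph)

theorem birkhoff_le_add_of_dist_le {ε η : ℝ} (hφ : ∀ p q, dist p q ≤ ε → φ p ≤ φ q + η)
    {x z : T.orbits n} (hxz : dist x z ≤ ε) : T.birkhoff φ n x ≤ T.birkhoff φ n z + n * η := by
  have hdist : ∀ i, dist (x.1 i) (z.1 i) ≤ ε := fun i => (dist_le_pi_dist x.1 z.1 i).trans hxz
  calc T.birkhoff φ n x ≤ ∑ i : Fin n, (φ ⟨(z.1 i.castSucc, z.1 i.succ), z.2 i⟩ + η) :=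
        Finset.sum_le_sum fun i _ => hφ _ _ (max_le (hdist _) (hdist _))
    _ = T.birkhoff φ n z + n * η := by
        rw [Finset.sum_add_distrib, Finset.sum_const, Finset.card_fin, nsmul_eq_mul, birkhoff]

theorem eventually_le_add_of_dist_le [CompactSpace X] (φ : C(T.graph, ℝ)) {η : ℝ} (hη : 0 < η) :
    ∀ᶠ ε in 𝓝[>] (0 : ℝ), ∀ p q, dist p q ≤ ε → φ p ≤ φ q + η := by
  obtain ⟨r, hr, hφ⟩ := Metric.uniformContinuous_iff.1
    (CompactSpace.uniformContinuous_of_continuous φ.continuous) η hη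
  filter_upwards [Ioo_mem_nhdsGT hr] with ε hε p q hpq
  have hlt := hφ (hpq.trans_lt hε.2)
  rw [Real.dist_eq] at hlt
  linarith [(abs_lt.1 hlt).2]

end BirkhoffOscillation

section ItineraryWeight

variable {X : Type*} [MetricSpace X] {T : Correspondence X} {φ : C(T.graph, ℝ)} {n : ℕ}

/-- The probability of guessing the itinerary `s` of an orbit by drawing a point `z` of `E` with
probability proportional to `exp (Sₙφ z)` and then guessing each coordinate of `s` independently,
with the weights given by the corresponding coordinate of `z`. -/
noncomputable def itineraryWeight {κ : Type*} (T : Correspondence X) (φ : C(T.graph, ℝ)) {n : ℕ}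
    (E : Finset (T.orbits n)) (weight : X → κ → ℝ) (s : Fin (n + 1) → κ) : ℝ :=
  ∑ z ∈ E, Real.exp (T.birkhoff φ n z) / (∑ z ∈ E, Real.exp (T.birkhoff φ n z)) *
    ∏ i, weight (z.1 i) (s i)

variable [MeasurableSpace X] {A : FinMeasPartition X} {ε η : ℝ} {score : X → ℝ}
  {weight : X → Fin A.card → ℝ}

theorem itineraryWeight_summand_nonneg (hA : A.IsCellPredictor ε score weight)
    (E : Finset (T.orbits n)) (s : Fin (n + 1) → Fin A.card) (z : T.orbits n) :
    0 ≤ Real.exp (T.birkhoff φ n z) / (∑ z ∈ E, Real.exp (T.birkhoff φ n z)) *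
      ∏ i, weight (z.1 i) (s i) :=
  mul_nonneg (by positivity) (Finset.prod_nonneg fun i _ => hA.nonneg _ _)

theorem itineraryWeight_nonneg (hA : A.IsCellPredictor ε score weight) (E : Finset (T.orbits n))
    (s : Fin (n + 1) → Fin A.card) : 0 ≤ T.itineraryWeight φ E weight s :=
  Finset.sum_nonneg fun z _ => itineraryWeight_summand_nonneg hA E s z

theorem sum_itineraryWeight_le_one (hA : A.IsCellPredictor ε score weight)
    (E : Finset (T.orbits n)) : ∑ s, T.itineraryWeight φ E weight s ≤ 1 := by
  have sum_div_le_one : ∑ z ∈ E, Real.exp (T.birkhoff φ n z) /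
      (∑ z ∈ E, Real.exp (T.birkhoff φ n z)) ≤ 1 := by
    rw [← Finset.sum_div]
    exact div_self_le_one _
  have mixture_le_one := sum_mixture_prod_le_one (fun z => by positivity) sum_div_le_one
    (fun z (i : Fin (n + 1)) j => hA.nonneg (z.1 i) j) fun z i => hA.sum_le_one (z.1 i)
  exact mixture_le_one

theorem exp_le_itineraryWeight (hA : A.IsCellPredictor ε score weight)
    (hφ : ∀ p q, dist p q ≤ ε → φ p ≤ φ q + η) {E : Finset (T.orbits n)}
    (hE : ∀ x, ∃ z ∈ E, dist x z ≤ ε) {x : T.orbits n} {s : Fin (n + 1) → Fin A.card}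
    (hs : ∀ i, x.1 i ∈ A.part (s i)) :
    Real.exp (T.birkhoff φ n x + ∑ i, score (x.1 i) -
      (n * η + Real.log (∑ z ∈ E, Real.exp (T.birkhoff φ n z)))) ≤
      T.itineraryWeight φ E weight s := by
  obtain ⟨z, hz, hxz⟩ := hE x
  set Z := ∑ z ∈ E, Real.exp (T.birkhoff φ n z) with hZdef
  have hZ : 0 < Z := Finset.sum_pos (fun _ _ => Real.exp_pos _) ⟨z, hz⟩
  have birkhoff_le := birkhoff_le_add_of_dist_le hφ hxz
  calc Real.exp (T.birkhoff φ n x + ∑ i, score (x.1 i) - (n * η + Real.log Z))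
      ≤ Real.exp (T.birkhoff φ n z - Real.log Z + ∑ i, score (x.1 i)) :=
        Real.exp_le_exp.2 (by linarith)
    _ = Real.exp (T.birkhoff φ n z) / Z * Real.exp (∑ i, score (x.1 i)) := by
        rw [Real.exp_add, Real.exp_sub, Real.exp_log hZ]
    _ ≤ Real.exp (T.birkhoff φ n z) / Z * ∏ i, weight (z.1 i) (s i) := by
        gcongr
        exact hA.exp_sum_score_le hs fun i => (dist_le_pi_dist x.1 z.1 i).trans hxz
    _ ≤ T.itineraryWeight φ E weight s :=
        Finset.single_le_sum (fun z _ => itineraryWeight_summand_nonneg hA E s z) hz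

end ItineraryWeight

section Comparison

variable {X : Type*} [MetricSpace X] [CompactSpace X] [MeasurableSpace X] [BorelSpace X]
  {T : Correspondence X} {Q : Kernel X X} [IsMarkovKernel Q] {μ : Measure X}

theorem Supports.ae_mem_orbits [SFinite μ] (hQ : T.Supports Q) (hμ : Q.Invariant μ) (n : ℕ) :
    ∀ᵐ x ∂(μ.bind (pathKernel Q n)), x ∈ T.orbits n :=
  ae_all_iff.2 fun i =>
    (measurePreserving_pair_pathKernel hμ n i).quasiMeasurePreserving.ae hQ.ae_mem_graph

theorem integrable_sum_extend_pathKernel [IsFiniteMeasure μ] (hμ : Q.Invariant μ)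
    (φ : C(T.graph, ℝ)) (n : ℕ) :
    Integrable (fun x => ∑ i : Fin n, Function.extend Subtype.val φ 0 (x i.castSucc, x i.succ))
      (μ.bind (pathKernel Q n)) :=
  integrable_sum_comp_measurePreserving (measurePreserving_pair_pathKernel hμ n)
    (integrable_extend φ _)

theorem Supports.integral_sum_extend_pathKernel [IsFiniteMeasure μ] (hQ : T.Supports Q)
    (hμ : Q.Invariant μ) (φ : C(T.graph, ℝ)) (n : ℕ) :
    ∫ x, ∑ i : Fin n, Function.extend Subtype.val φ 0 (x i.castSucc, x i.succ)
      ∂(μ.bind (pathKernel Q n)) = n * T.doubleIntegral Q μ φ := by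
  rw [hQ.doubleIntegral_eq_integral_extend]
  simpa only [Fintype.card_fin, nsmul_eq_mul] using
    integral_sum_comp_measurePreserving (measurePreserving_pair_pathKernel hμ n)
      (integrable_extend φ _)

variable [IsProbabilityMeasure μ]

theorem productEntropy_pathKernel_le (hQ : T.Supports Q) (hμ : Q.Invariant μ)
    {A : FinMeasPartition X} {ε η : ℝ} {score : X → ℝ} {weight : X → Fin A.card → ℝ}
    (hA : A.IsCellPredictor ε score weight) (hscore : Integrable score μ) {φ : C(T.graph, ℝ)}
    (hφ : ∀ p q, dist p q ≤ ε → φ p ≤ φ q + η) {n : ℕ} {E : Finset (T.orbits n)}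
    (hE : ∀ x, ∃ z ∈ E, dist x z ≤ ε) :
    productEntropy (μ.bind (pathKernel Q n)) A ≤
      Real.log (∑ z ∈ E, Real.exp (T.birkhoff φ n z)) + n * η - n * T.doubleIntegral Q μ φ -
        (n + 1) * ∫ x, score x ∂μ := by
  set ν := μ.bind (pathKernel Q n)
  set c := n * η + Real.log (∑ z ∈ E, Real.exp (T.birkhoff φ n z))
  let S : (Fin (n + 1) → X) → ℝ := fun x =>
    ∑ i : Fin n, Function.extend Subtype.val φ 0 (x i.castSucc, x i.succ)
  let L : (Fin (n + 1) → X) → ℝ := fun x => ∑ i, score (x i)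
  have heval := measurePreserving_eval_pathKernel hμ n
  have integrable_S : Integrable S ν := integrable_sum_extend_pathKernel hμ φ n
  have integrable_L : Integrable L ν := integrable_sum_comp_measurePreserving heval hscore
  have integral_L : ∫ x, L x ∂ν = (n + 1) * ∫ x, score x ∂μ := by
    simpa using integral_sum_comp_measurePreserving heval hscore
  have exp_le : ∀ᵐ x ∂ν, ∀ s, (∀ i, x i ∈ A.part (s i)) →
      Real.exp (S x + L x - c) ≤ T.itineraryWeight φ E weight s := by
    filter_upwards [hQ.ae_mem_orbits hμ n] with x hx s hs
    simpa only [S, sum_extend_eq_birkhoff ⟨x, hx⟩] using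
      exp_le_itineraryWeight hA hφ hE (x := ⟨x, hx⟩) hs
  calc productEntropy ν A
      ≤ -∫ x, (S x + L x - c) ∂ν :=
        productEntropy_le_neg_integral A (itineraryWeight_nonneg hA E)
          (sum_itineraryWeight_le_one hA E)
          ((integrable_S.add integrable_L).sub (integrable_const c)) exp_le
    _ = -(∫ x, S x ∂ν + ∫ x, L x ∂ν - c) := by
        have integral_SL := integral_add integrable_S integrable_L
        have integral_SLc := integral_sub (integrable_S.add integrable_L) (integrable_const c)
        rw [integral_const, probReal_univ, one_smul] at integral_SLc
        exact congrArg _ (integral_SLc.trans (congrArg (· - c) integral_SL))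
    _ = _ := by
        rw [hQ.integral_sum_extend_pathKernel hμ, integral_L]
        ring

theorem kernelEntropyPartition_le (hQ : T.Supports Q) (hμ : Q.Invariant μ)
    (A : FinMeasPartition X) {φ : C(T.graph, ℝ)} {a : ℝ} (ha : T.pressure φ < a) :
    kernelEntropyPartition Q μ A ≤ ((a - T.doubleIntegral Q μ φ : ℝ) : EReal) := by
  obtain ⟨b, hb, hba⟩ := EReal.lt_iff_exists_real_btwn.1 ha
  obtain ⟨η, hη, rfl⟩ : ∃ η : ℝ, 0 < η ∧ a = b + 3 * η :=
    ⟨(a - b) / 3, by linarith [EReal.coe_lt_coe_iff.1 hba], by ring⟩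
  obtain ⟨score, hscore, integral_score, exists_weight⟩ := A.exists_isCellPredictor μ hη
  obtain ⟨ε, ⟨weight, hA⟩, hφ, hε⟩ := (exists_weight.and
    ((eventually_le_add_of_dist_le φ hη).and self_mem_nhdsWithin)).exists
  refine limsup_le_of_le (by isBoundedDefault) ?_
  filter_upwards [eventually_separatedSum_le ((pressureAt_le_pressure hε).trans_lt hb),
    eventually_ge_atTop 1] with n hn hn1
  obtain ⟨E, hEsep, hEnet⟩ := exists_finset_separated_net (T.orbits n) hε
  have log_sum_le : Real.log (∑ z ∈ E, Real.exp (T.birkhoff φ n z)) ≤ n * b := by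
    have : Nonempty X := nonempty_of_isProbabilityMeasure μ
    obtain ⟨z, hz, -⟩ := hEnet (Classical.arbitrary _)
    rw [Real.log_le_iff_le_exp (Finset.sum_pos (fun _ _ => Real.exp_pos _) ⟨z, hz⟩)]
    exact (separatedSum_le_ofReal_iff (Real.exp_pos _).le).1 hn E hEsep
  have entropy_le := productEntropy_pathKernel_le hQ hμ hA hscore hφ hEnet
  replace hn1 : (1 : ℝ) ≤ n := by exact_mod_cast hn1
  rw [EReal.coe_le_coe_iff]
  calc productEntropy (μ.bind (pathKernel Q n)) A / ((n : ℝ) + 1)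
      ≤ productEntropy (μ.bind (pathKernel Q n)) A / n :=
        div_le_div_of_nonneg_left (productEntropy_nonneg A) (by positivity) (by linarith)
    _ ≤ b + 3 * η - T.doubleIntegral Q μ φ := by
        rw [div_le_iff₀ (by positivity)]
        nlinarith

theorem kernelEntropy_le_pressure_sub (hQ : T.Supports Q) (hμ : Q.Invariant μ)
    (φ : C(T.graph, ℝ)) :
    kernelEntropy Q μ ≤ T.pressure φ - (T.doubleIntegral Q μ φ : EReal) :=
  iSup_le fun A => le_sub_coe_of_forall_lt fun _ ha => kernelEntropyPartition_le hQ hμ A ha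

end Comparison

end Correspondence

namespace Correspondence

section VariationalPrinciple

variable {X : Type*} [MetricSpace X] [CompactSpace X] [MeasurableSpace X] [BorelSpace X]
  {T : Correspondence X} {Q : Kernel X X} [IsMarkovKernel Q] {μ : Measure X}
  [IsProbabilityMeasure μ]

theorem abstractEntropy_le_pressure_sub (hQ : T.Supports Q) (φ : C(T.graph, ℝ)) :
    T.abstractEntropy Q μ ≤ T.pressure φ - (T.doubleIntegral Q μ φ : EReal) := by
  refine le_sub_coe_of_forall_lt fun a ha => ?_
  have pressure_nonpos : T.pressure (-(ContinuousMap.const _ a - φ)) ≤ 0 := by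
    have hadd : -(ContinuousMap.const _ a - φ) = φ + ContinuousMap.const _ (-a) :=
      (neg_sub _ φ).trans (sub_eq_add_neg φ _)
    rw [hadd, pressure_add_const, EReal.coe_neg, ← sub_eq_add_neg]
    exact EReal.sub_le_of_le_add (by simpa using ha.le)
  have doubleIntegral_eq : T.doubleIntegral Q μ (ContinuousMap.const _ a - φ) =
      a - T.doubleIntegral Q μ φ := by
    rw [sub_eq_add_neg, hQ.doubleIntegral_add, hQ.doubleIntegral_neg, hQ.doubleIntegral_const,
      ← sub_eq_add_neg]
  exact iInf₂_le_of_le (ContinuousMap.const _ a - φ) pressure_nonpos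
    (by rw [doubleIntegral_eq])

theorem abstractEntropy_eq_iInf (hQ : T.Supports Q) :
    T.abstractEntropy Q μ =
      ⨅ φ : C(T.graph, ℝ), (T.pressure φ - (T.doubleIntegral Q μ φ : EReal)) := by
  refine le_antisymm (le_iInf (abstractEntropy_le_pressure_sub hQ))
    (le_iInf₂ fun φ hφ => iInf_le_of_le (-φ) ?_)
  rw [hQ.doubleIntegral_neg, EReal.coe_neg, sub_eq_add_neg, neg_neg]
  exact add_le_of_nonpos_left hφ

theorem abstractEntropy_add_le_pressure (hQ : T.Supports Q) (φ : C(T.graph, ℝ)) :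
    T.abstractEntropy Q μ + (T.doubleIntegral Q μ φ : EReal) ≤ T.pressure φ :=
  (EReal.le_sub_iff_add_le (by simp) (by simp)).1 (abstractEntropy_le_pressure_sub hQ φ)

theorem abstractEntropy_eq_top (h : T.topEntropy = ⊤) (hQ : T.Supports Q) :
    T.abstractEntropy Q μ = ⊤ := by
  simp only [abstractEntropy_eq_iInf hQ, iInf_eq_top, (pressure_eq_top_iff_topEntropy _).2 h,
    EReal.top_sub_coe, implies_true]

theorem exists_invariant_pressure_le [Nonempty X] (h : T.topEntropy < ⊤) (φ : C(T.graph, ℝ)) :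
    ∃ (Q : Kernel X X) (μ : Measure X), IsMarkovKernel Q ∧ T.Supports Q ∧
      IsProbabilityMeasure μ ∧ Q.Invariant μ ∧
      T.pressure φ ≤ T.abstractEntropy Q μ + (T.doubleIntegral Q μ φ : EReal) := by
  obtain ⟨Q, μ, hQm, hQ, hμ, hinv, hsub⟩ := T.exists_kernel_subgradient
    (convexOn_toReal_pressure h) (fun _ _ _ => toReal_pressure_le_add_of_le h)
    (fun φ u => by rw [pressure_add_coboundary]) φ
  refine ⟨Q, μ, hQm, hQ, hμ, hinv, ?_⟩
  rw [← EReal.sub_le_iff_le_add (by simp) (by simp), abstractEntropy_eq_iInf hQ]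
  refine le_iInf fun ψ => ?_
  rw [← coe_toReal_pressure h, ← coe_toReal_pressure h ψ]
  exact_mod_cast hsub ψ

theorem exists_invariant_eq_pressure [Nonempty X] (T : Correspondence X) (φ : C(T.graph, ℝ)) :
    ∃ (Q : Kernel X X) (μ : Measure X), IsMarkovKernel Q ∧ T.Supports Q ∧
      IsProbabilityMeasure μ ∧ Q.Invariant μ ∧
      T.pressure φ = T.abstractEntropy Q μ + (T.doubleIntegral Q μ φ : EReal) := by
  rcases eq_or_ne T.topEntropy ⊤ with htop | hfin
  · obtain ⟨Q, μ, hQm, hQ, hμ, hinv⟩ := T.exists_invariant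
    refine ⟨Q, μ, hQm, hQ, hμ, hinv, ?_⟩
    rw [abstractEntropy_eq_top htop hQ, (pressure_eq_top_iff_topEntropy φ).2 htop,
      EReal.top_add_coe]
  · obtain ⟨Q, μ, hQm, hQ, hμ, hinv, hle⟩ := exists_invariant_pressure_le hfin.lt_top φ
    exact ⟨Q, μ, hQm, hQ, hμ, hinv, hle.antisymm (abstractEntropy_add_le_pressure hQ φ)⟩

theorem doubleIntegral_coboundary_nonpos (h : T.topEntropy < ⊤) (hQ : T.Supports Q)
    {φ : C(T.graph, ℝ)}
    (heq : T.abstractEntropy Q μ + (T.doubleIntegral Q μ φ : EReal) = T.pressure φ)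
    (u : C(X, ℝ)) : T.doubleIntegral Q μ (T.coboundary u) ≤ 0 := by
  have : Nonempty X := nonempty_of_isProbabilityMeasure μ
  have hle := abstractEntropy_add_le_pressure (μ := μ) hQ (φ + T.coboundary u)
  rw [pressure_add_coboundary, hQ.doubleIntegral_add, EReal.coe_add, ← add_assoc, heq,
    ← coe_toReal_pressure h φ] at hle
  exact (add_le_iff_nonpos_right _).1 (by exact_mod_cast hle)

theorem invariant_of_eq_pressure (h : T.topEntropy < ⊤) (hQ : T.Supports Q) {φ : C(T.graph, ℝ)}
    (heq : T.abstractEntropy Q μ + (T.doubleIntegral Q μ φ : EReal) = T.pressure φ) :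
    Q.Invariant μ := by
  have nonpos := doubleIntegral_coboundary_nonpos h hQ heq
  refine hQ.invariant_of_doubleIntegral_coboundary fun u => (nonpos u).antisymm ?_
  have := nonpos (-u)
  rwa [coboundary_neg, hQ.doubleIntegral_neg, neg_nonpos] at this

end VariationalPrinciple

end Correspondence

theorem mainTheorem1 {X : Type*} [MetricSpace X] [CompactSpace X] [Nonempty X]
    [MeasurableSpace X] [BorelSpace X] (T : Correspondence X) :
    -- the variational principle, over all probability measures and over the invariant ones
    (∀ φ : C(T.graph, ℝ),
      IsGreatest {p : EReal | ∃ (Q : Kernel X X) (μ : Measure X), IsMarkovKernel Q ∧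
          T.Supports Q ∧ IsProbabilityMeasure μ ∧
          p = T.abstractEntropy Q μ + (T.doubleIntegral Q μ φ : EReal)} (T.pressure φ) ∧
      IsGreatest {p : EReal | ∃ (Q : Kernel X X) (μ : Measure X), IsMarkovKernel Q ∧
          T.Supports Q ∧ IsProbabilityMeasure μ ∧ Q.Invariant μ ∧
          p = T.abstractEntropy Q μ + (T.doubleIntegral Q μ φ : EReal)} (T.pressure φ)) ∧
    -- maximizing pairs are invariant
    (T.topEntropy < ⊤ → ∀ (φ : C(T.graph, ℝ)) (Q : Kernel X X) (μ : Measure X),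
      IsMarkovKernel Q → T.Supports Q → IsProbabilityMeasure μ →
      T.abstractEntropy Q μ + (T.doubleIntegral Q μ φ : EReal) = T.pressure φ →
      Q.Invariant μ) ∧
    -- the inverse variational principle
    (∀ (Q : Kernel X X) (μ : Measure X), IsMarkovKernel Q → T.Supports Q →
      IsProbabilityMeasure μ →
      T.abstractEntropy Q μ =
        ⨅ φ : C(T.graph, ℝ), (T.pressure φ - (T.doubleIntegral Q μ φ : EReal))) ∧
    -- comparison with the measure-theoretic entropy
    (∀ (Q : Kernel X X) (μ : Measure X), IsMarkovKernel Q → T.Supports Q →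
      IsProbabilityMeasure μ → Q.Invariant μ →
      0 ≤ kernelEntropy Q μ ∧ kernelEntropy Q μ ≤ T.abstractEntropy Q μ) := by
  refine ⟨fun φ => ?_, ?_, ?_, ?_⟩
  · obtain ⟨Q, μ, hQm, hQ, hμ, hinv, heq⟩ := T.exists_invariant_eq_pressure φ
    refine ⟨⟨⟨Q, μ, hQm, hQ, hμ, heq⟩, ?_⟩, ⟨⟨Q, μ, hQm, hQ, hμ, hinv, heq⟩, ?_⟩⟩
    · rintro _ ⟨Q, μ, _, hQ, _, rfl⟩
      exact Correspondence.abstractEntropy_add_le_pressure hQ φ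
    · rintro _ ⟨Q, μ, _, hQ, _, -, rfl⟩
      exact Correspondence.abstractEntropy_add_le_pressure hQ φ
  · intro h φ Q μ _ hQ _ heq
    exact Correspondence.invariant_of_eq_pressure h hQ heq
  · intro Q μ _ hQ _
    exact Correspondence.abstractEntropy_eq_iInf hQ
  · intro Q μ _ hQ _ hinv
    refine ⟨kernelEntropy_nonneg Q μ, ?_⟩
    rw [Correspondence.abstractEntropy_eq_iInf hQ]
    exact le_iInf (Correspondence.kernelEntropy_le_pressure_sub hQ hinv)
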